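/- An argumentation framework (AF) $F=\langle A,R\rangle$ consists of a set $A$ of arguments and a set $R\subseteq A\times A$ of attacks. For $S\subseteq A$ let $S^+_F=\{a\in A: (b,a)\in R \text{ for some } b\in S\}$ and let $\Gamma_F(S)$ be the set of all $a\in A$ such that every $b$ with $(b,a)\in R$ lies in $S^+_F$. The set $S$ is conflict-free if $S\cap S^+_F=\emptyset$. It is an $\mathtt{ad}$-extension (admissible) if it is conflict-free and $S\subseteq\Gamma_F(S)$; an $\mathtt{st}$-extension (stable) if it is conflict-free and $S^+_F=A\setminus S$; a $\mathtt{co}$-extension (complete) if it is admissible and $\Gamma_F(S)\subseteq S$; a $\mathtt{gr}$-extension (grounded) if it is $\subseteq$-minimal among the complete extensions; and a $\mathtt{pr}$-extension (preferred) if it is $\subseteq$-maximal among the admissible sets. For a verification status $j=(\sigma,\mathit{true})$ (respectively $j=(\sigma,\mathit{false})$), also written $\sigma$-$\mathit{true}$ (respectively $\sigma$-$\mathit{false}$), a set $S$ is $j$ in $F$ if $S$ is (respectively is not) a $\sigma$-extension of $F$; a set that is not contained in $A$ is not an extension of $F$. An incomplete argumentation framework (IAF) is $I=\langle A,A^?,R,R^?\rangle$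 with disjoint sets $A,A^?$ of certain and uncertain arguments and disjoint sets $R,R^?\subseteq(A\cup A^?)\times(A\cup A^?)$ of certain and uncertain attacks. A partial completion of $I$ is an IAF $\langle A',A^{?\prime},R',R^{?\prime}\rangle$ with $A\subseteq A'\subseteq A\cup A^?$, $R\cap\big((A'\cup A^{?\prime})\times(A'\cup A^{?\prime})\big)\subseteq R'\subseteq R\cup R^?$, $A^{?\prime}\subseteq A^?$ and $R^{?\prime}\subseteq R^?$; let $\mathrm{part}(I)$ be the set of all of them. A completion of $I$ is an AF $\langle A',R'\cap(A'\times A')\rangle$ arising from some $\langle A',A^{?\prime},R',R^{?\prime}\rangle\in \mathrm{part}(I)$. A set $S$ of arguments is stable-$j$ w.r.t. $I$ if $S$ is $j$ in every completion of $I$. For an uncertain element $e\in A^?\cup R^?$, the IAF $I+\{e\}$ is obtained from $I$ by making $e$ certain, and $I-\{e\}$ by deleting $e$, together with all attacks from or to $e$ if $e$ is an argument. For a verification status $j$, the problem $j$-STRONG-RELEVANCE is the following. Given: a finite IAF $I=\langle A,A^?,R,R^?\rangle$, a set $S\subseteq A\cup A^?$ such that $S$ is stable-$j$ w.r.t. at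 least one $I'\in\mathrm{part}(I)$, an action $\mathbf a\in\{\text{addition},\text{removal}\}$ and an uncertain element $e\in A^?\cup R^?$. Question: is $\mathbf a$ of $e$ strongly $j$-relevant for $S$ w.r.t. $I$, i.e., is $S$ not stable-$j$ w.r.t. $I'$ for every $I'\in\mathrm{part}(I-\{e\})$ (if $\mathbf a$ is addition), respectively for every $I'\in\mathrm{part}(I+\{e\})$ (if $\mathbf a$ is removal)? Since the permitted inputs are restricted by the condition on $S$, the problem is said to be in a complexity class if some language in that class gives the right answer on all permitted inputs. The following hold. 1. For every $j\in\{\mathtt{ad},\mathtt{st},\mathtt{co},\mathtt{gr}\}\times\{\mathit{true},\mathit{false}\}$, $j$-STRONG-RELEVANCE is in $\mathrm{P}$. 2. $\mathtt{pr}$-$\mathit{true}$-STRONG-RELEVANCE is in $\Pi_2^p$. 3. $\mathtt{pr}$-$\mathit{false}$-STRONG-RELEVANCE is in $\mathrm{coNP}$. -/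

import Mathlib

noncomputable section

/-! ### Complexity classes -/

namespace Complexity

open Turing Computability

/-- The predicate `Q` on a type whose elements are written as words by `enc` is decided by a Turing
machine that halts, with its one-bit answer as output, within polynomially many steps in the length
of the input word. -/
def PolyTimeDecidable {α Γ : Type} (enc : α → List Γ) (Q : α → Prop) : Prop :=
  open Classical in
  Nonempty (TM2ComputableInPolyTime enc encodeBool (fun a => decide (Q a)))

/-- The input `x#y` of a verifier; `none` is the separator `#`. -/
def encodePair (q : List Bool × List Bool) : List (Option Bool) :=
  q.1.map some ++ none :: q.2.map some

/-- The input `x#y#z` of a verifier; `none` is the separator `#`. -/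
def encodeTriple (q : List Bool × List Bool × List Bool) : List (Option Bool) :=
  q.1.map some ++ none :: (q.2.1.map some ++ none :: q.2.2.map some)

/-- The class `P` of languages over `{0,1}`. -/
def ClassP : Set (Set (List Bool)) :=
  {L | PolyTimeDecidable (fun w : List Bool => w) (fun w => w ∈ L)}

/-- The class `NP`. -/
def ClassNP : Set (Set (List Bool)) :=
  {L | ∃ (V : List Bool × List Bool → Prop) (p : Polynomial ℕ),
    PolyTimeDecidable encodePair V ∧
    ∀ x, x ∈ L ↔ ∃ y : List Bool, y.length ≤ p.eval x.length ∧ V (x, y)}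

/-- The class `coNP`. -/
def ClassCoNP : Set (Set (List Bool)) := {L | Lᶜ ∈ ClassNP}

/-- The class `Σ₂ᵖ` of the polynomial hierarchy. -/
def ClassSigma2 : Set (Set (List Bool)) :=
  {L | ∃ (V : List Bool × List Bool × List Bool → Prop) (p : Polynomial ℕ),
    PolyTimeDecidable encodeTriple V ∧
    ∀ x, x ∈ L ↔ ∃ y : List Bool, y.length ≤ p.eval x.length ∧
      ∀ z : List Bool, z.length ≤ p.eval x.length → V (x, y, z)}

/-- The class `Π₂ᵖ` of the polynomial hierarchy. -/
def ClassPi2 : Set (Set (List Bool)) := {L | Lᶜ ∈ ClassSigma2}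

/-- A decision problem whose inputs are restricted to `yes ∪ no`. -/
structure PromiseProblem where
  yes : Set (List Bool)
  no : Set (List Bool)

/-- A problem with restricted inputs is in the class `C` if some language in `C` gives the right
answer on all the admitted inputs. -/
def PromiseProblem.InClass (Q : PromiseProblem) (C : Set (Set (List Bool))) : Prop :=
  ∃ L ∈ C, (∀ w ∈ Q.yes, w ∈ L) ∧ (∀ w ∈ Q.no, w ∉ L)

end Complexity

/-! ### Argumentation frameworks -/

namespace Argumentation

/-- An abstract argumentation framework with arguments taken from the type `α`. -/
structure AF (α : Type) where
  /-- the arguments -/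
  A : Set α
  /-- the attacks -/
  R : Set (α × α)
  R_sub : R ⊆ A ×ˢ A

namespace AF

variable {α : Type}

/-- The set `S⁺` of the arguments that `S` attacks. -/
def attackedBy (F : AF α) (S : Set α) : Set α := {a ∈ F.A | ∃ b ∈ S, (b, a) ∈ F.R}

def ConflictFree (F : AF α) (S : Set α) : Prop := S ∩ F.attackedBy S = ∅

/-- `S` defends `a`: all attackers of `a` are attacked by `S`. -/
def Defends (F : AF α) (S : Set α) (a : α) : Prop :=
  ∀ b, (b, a) ∈ F.R → b ∈ F.attackedBy S

/-- The characteristic function `Γ`. -/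
def char (F : AF α) (S : Set α) : Set α := {a ∈ F.A | F.Defends S a}

/-- The admissible sets. -/
def ad (F : AF α) : Set (Set α) :=
  {S | S ⊆ F.A ∧ F.ConflictFree S ∧ S ⊆ F.char S}

/-- The stable extensions. -/
def st (F : AF α) : Set (Set α) :=
  {S | S ⊆ F.A ∧ F.ConflictFree S ∧ F.attackedBy S = F.A \ S}

/-- The complete extensions. -/
def co (F : AF α) : Set (Set α) := {S | S ∈ F.ad ∧ ∀ a ∈ F.char S, a ∈ S}

/-- The grounded extensions. -/
def gr (F : AF α) : Set (Set α) := {S | Minimal (fun T => T ∈ F.co) S}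

/-- The preferred extensions. -/
def pr (F : AF α) : Set (Set α) := {S | Maximal (fun T => T ∈ F.ad) S}

end AF

/-- The names of the five semantics. -/
inductive Semantics
  | ad | st | co | gr | pr

/-- The set `σ(F)` of the `σ`-extensions of `F`. -/
def Semantics.ext {α : Type} : Semantics → AF α → Set (Set α)
  | .ad, F => F.ad
  | .st, F => F.st
  | .co, F => F.co
  | .gr, F => F.gr
  | .pr, F => F.pr

/-- `S` has the verification status `j = (σ, b)` in `F`: it is a `σ`-extension if `b = true`, and
is not one if `b = false`. -/
def HasStatus {α : Type} (F : AF α) (S : Set α) : Semantics × Bool → Prop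
  | (σ, true) => S ∈ σ.ext F
  | (σ, false) => S ∉ σ.ext F

/-! ### Incomplete argumentation frameworks -/

/-- An incomplete argumentation framework `⟨A, A?, R, R?⟩`. -/
structure IAF (α : Type) where
  /-- the certain arguments -/
  A : Set α
  /-- the uncertain arguments -/
  Aq : Set α
  /-- the certain attacks -/
  R : Set (α × α)
  /-- the uncertain attacks -/
  Rq : Set (α × α)
  disj_A : Disjoint A Aq
  disj_R : Disjoint R Rq
  R_sub : R ⊆ (A ∪ Aq) ×ˢ (A ∪ Aq)
  Rq_sub : Rq ⊆ (A ∪ Aq) ×ˢ (A ∪ Aq)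

/-- An argument or an attack. -/
inductive Element (α : Type)
  | arg (a : α)
  | att (r : α × α)

namespace IAF

variable {α : Type}

/-- `J` is a partial completion of `I`. -/
def IsPart (I J : IAF α) : Prop :=
  (I.A ⊆ J.A ∧ J.A ⊆ I.A ∪ I.Aq) ∧
  (I.R ∩ ((J.A ∪ J.Aq) ×ˢ (J.A ∪ J.Aq)) ⊆ J.R ∧ J.R ⊆ I.R ∪ I.Rq) ∧
  J.Aq ⊆ I.Aq ∧ J.Rq ⊆ I.Rq

/-- The set of the partial completions of `I`. -/
def part (I : IAF α) : Set (IAF α) := {J | I.IsPart J}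

/-- The projection of `I` on its certain elements. -/
def cert (I : IAF α) : AF α where
  A := I.A
  R := I.R ∩ (I.A ×ˢ I.A)
  R_sub := Set.inter_subset_right

/-- `F` is a completion of `I`. -/
def IsCompletion (I : IAF α) (F : AF α) : Prop := ∃ J ∈ I.part, F = J.cert

/-- `S` is stable-`j` w.r.t. `I`. -/
def Stable (I : IAF α) (S : Set α) (j : Semantics × Bool) : Prop :=
  ∀ F, I.IsCompletion F → HasStatus F S j

/-- `e` is an uncertain element of `I`. -/
def Uncertain (I : IAF α) : Element α → Prop
  | .arg a => a ∈ I.Aq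
  | .att r => r ∈ I.Rq

/-- `I + R₀` for a set `R₀` of uncertain attacks. -/
def addAttacks (I : IAF α) (R₀ : Set (α × α)) (h : R₀ ⊆ I.Rq) : IAF α where
  A := I.A
  Aq := I.Aq
  R := I.R ∪ R₀
  Rq := I.Rq \ R₀
  disj_A := I.disj_A
  disj_R := Set.disjoint_union_left.2
    ⟨I.disj_R.mono_right Set.sdiff_subset, Set.disjoint_sdiff_right⟩
  R_sub := Set.union_subset I.R_sub (h.trans I.Rq_sub)
  Rq_sub := Set.sdiff_subset.trans I.Rq_sub

/-- `I - R₀` for a set `R₀` of uncertain attacks. -/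
def removeAttacks (I : IAF α) (R₀ : Set (α × α)) : IAF α where
  A := I.A
  Aq := I.Aq
  R := I.R
  Rq := I.Rq \ R₀
  disj_A := I.disj_A
  disj_R := I.disj_R.mono_right Set.sdiff_subset
  R_sub := I.R_sub
  Rq_sub := Set.sdiff_subset.trans I.Rq_sub

/-- `I + A₀` for a set `A₀` of uncertain arguments. -/
def addArgs (I : IAF α) (A₀ : Set α) (h : A₀ ⊆ I.Aq) : IAF α where
  A := I.A ∪ A₀
  Aq := I.Aq \ A₀
  R := I.R
  Rq := I.Rq
  disj_A := Set.disjoint_union_left.2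
    ⟨I.disj_A.mono_right Set.sdiff_subset, Set.disjoint_sdiff_right⟩
  disj_R := I.disj_R
  R_sub := by
    rw [Set.union_assoc, Set.union_sdiff_cancel h]; exact I.R_sub
  Rq_sub := by
    rw [Set.union_assoc, Set.union_sdiff_cancel h]; exact I.Rq_sub

/-- The attacks of `I`, certain or not, from or to an argument in `A₀`. -/
def attacksAt (I : IAF α) (A₀ : Set α) : Set (α × α) :=
  {r ∈ I.R ∪ I.Rq | r.1 ∈ A₀ ∨ r.2 ∈ A₀}

/-- `I - A₀` for a set `A₀` of uncertain arguments. -/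
def removeArgs (I : IAF α) (A₀ : Set α) : IAF α where
  A := I.A
  Aq := I.Aq \ A₀
  R := I.R \ I.attacksAt A₀
  Rq := I.Rq \ I.attacksAt A₀
  disj_A := I.disj_A.mono_right Set.sdiff_subset
  disj_R := I.disj_R.mono Set.sdiff_subset Set.sdiff_subset
  R_sub := by
    rintro ⟨a, b⟩ ⟨hr, hn⟩
    have h1 := I.R_sub hr
    simp only [attacksAt, Set.mem_ofPred_eq, Set.mem_union, Set.mem_prod, Set.mem_sdiff] at *
    tauto
  Rq_sub := by
    rintro ⟨a, b⟩ ⟨hr, hn⟩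
    have h1 := I.Rq_sub hr
    simp only [attacksAt, Set.mem_ofPred_eq, Set.mem_union, Set.mem_prod, Set.mem_sdiff] at *
    tauto

/-- `I + {e}` for an uncertain element `e`. -/
def add (I : IAF α) : (e : Element α) → I.Uncertain e → IAF α
  | .arg a, h => I.addArgs {a} (Set.singleton_subset_iff.2 h)
  | .att r, h => I.addAttacks {r} (Set.singleton_subset_iff.2 h)

/-- `I - {e}` for an uncertain element `e`. -/
def remove (I : IAF α) : (e : Element α) → I.Uncertain e → IAF α
  | .arg a, _ => I.removeArgs {a}
  | .att r, _ => I.removeAttacks {r}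

/-- Stability-`j` can be reached: `S` is stable-`j` w.r.t. some partial completion of `I`. -/
def CanReach (I : IAF α) (S : Set α) (j : Semantics × Bool) : Prop :=
  ∃ J ∈ I.part, J.Stable S j

end IAF

/-- The two actions on an uncertain element. -/
inductive Action
  | addition | removal

/-- The action on `e` is strongly `j`-relevant for `S` w.r.t. `I` (a notion for the case that
stability-`j` can be reached): after the opposite action, no partial completion is stable-`j`. -/
def StronglyRelevant {α : Type} (I : IAF α) (S : Set α) (j : Semantics × Bool)
    (e : Element α) (he : I.Uncertain e) : Action → Prop
  | .addition => ∀ J ∈ (I.remove e he).part, ¬ J.Stable S j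
  | .removal => ∀ J ∈ (I.add e he).part, ¬ J.Stable S j

/-! ### The decision problem -/

/-- The data of an instance: a finite IAF, a set of its arguments, an action and an uncertain
element. The arguments are named by numbers below `n`. -/
structure Input where
  n : ℕ
  I : IAF (Fin n)
  S : Set (Fin n)
  S_sub : S ⊆ I.A ∪ I.Aq
  act : Action
  e : Element (Fin n)
  he : I.Uncertain e

open Classical in
/-- The word for an instance: `n` in unary, one bit for the action, then for every number below `n`
the bits that tell whether it is a certain argument, an uncertain argument, an element of `S`, the
element `e`, and then for every pair of numbers (row by row) the bits that tell whether it is a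
certain attack, an uncertain attack, the element `e`. -/
def Input.encode (x : Input) : List Bool :=
  List.replicate x.n true ++ [false] ++
  [decide (x.act = Action.addition)] ++
  (List.finRange x.n).flatMap (fun a =>
    [decide (a ∈ x.I.A), decide (a ∈ x.I.Aq), decide (a ∈ x.S), decide (x.e = Element.arg a)]) ++
  (List.finRange x.n).flatMap (fun a => (List.finRange x.n).flatMap (fun b =>
    [decide ((a, b) ∈ x.I.R), decide ((a, b) ∈ x.I.Rq), decide (x.e = Element.att (a, b))]))

/-- The problem `j`-STRONG-RELEVANCE. Its inputs are restricted to those for which stability-`j`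
can be reached. -/
def strongRelevance (j : Semantics × Bool) : Complexity.PromiseProblem where
  yes := {w | ∃ x : Input, x.encode = w ∧ x.I.CanReach x.S j ∧
    StronglyRelevant x.I x.S j x.e x.he x.act}
  no := {w | ∃ x : Input, x.encode = w ∧ x.I.CanReach x.S j ∧
    ¬ StronglyRelevant x.I x.S j x.e x.he x.act}

end Argumentation

end

/-! Reaching stability is a matter of single completions. If `S` is stable-`j` w.r.t. a partial
completion, it is `j` in the completion formed by the certain elements of that partial completion.
Conversely, every completion is a partial completion without uncertain elements, whose only
completion is itself (`IAF.canReach_iff`). So an action is strongly relevant iff no completion of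
the IAF after the opposite action has status `j` (`Input.stronglyRelevant_iff`).

For `(σ, true)` one asks whether `S` can become an extension. The completion `IAF.favour` is the
best one for `S`: uncertain attacks on `S` are dropped and those from `S` kept, except on a set `U`
that is to remain undecided. This gives conditions on certain and possible attacks (`exists_ad_iff`,
`exists_st_iff`, `exists_co_iff`, `exists_gr_iff`). For `(σ, false)` one asks whether `S` is an
extension of every completion, and a few adversarial completions show which conditions are necessary
(`forall_ad_iff` and its analogues). All these conditions are first-order up to least fixed points
of monotone operators on sets of arguments.

For the preferred semantics, admissibility in a given completion is first-order. Hence "possibly not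
preferred" has an NP certificate (a completion and perhaps a larger admissible set), and "possibly
preferred" has the form: some completion withstands every challenging set.

The Turing machines come from one general theorem, `Query.polyTimeDecidable`: a first-order formula
about a word, preceded by finitely many inductive definitions of unary relations, is decidable in
polynomial time. It is proved by compiling formulas into a small structured language and that
language into `FinTM2`. What remains is to write the conditions as formulas over the encoding of an
instance. -/

noncomputable section

/-! ### A structured language for stack machines -/

namespace StackMachine

open Turing Function

/-- The symbols on the work stacks; `none` is the separator. -/
abbrev Sym := Option Bool

/-- The stacks of symbols. -/
inductive Reg
  | mem | left | new
  deriving DecidableEq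

instance : Fintype Reg := ⟨{.mem, .left, .new}, fun r => by cases r <;> simp⟩

/-- The unary counters. `val i` and `rem i` are the value of the variable `i` and the number of
values that are still to come. -/
inductive Ctr
  | num | tmp | tmp' | iter | iter'
  | val (i : Fin 4)
  | rem (i : Fin 4)
  deriving DecidableEq, Fintype

inductive Stk
  | inp | out
  | reg (r : Reg)
  | ctr (c : Ctr)
  deriving DecidableEq, Fintype

/-- A counter is a stack over a one-letter alphabet; its height is its value. -/
def Stk.Alph (Γ : Type) : Stk → Type
  | .inp => Γ
  | .out => Bool
  | .reg _ => Sym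
  | .ctr _ => Unit

/-- The finite control. -/
@[ext] structure Ctl where
  top : Option Sym
  flag : Bool
  res : Bool
  deriving Fintype

/-- The states of a program. -/
@[ext] structure St (Γ : Type) extends Ctl where
  inp : List Γ
  out : List Bool
  mem : List Sym
  left : List Sym
  new : List Sym
  ctr : Ctr → ℕ

namespace St

variable {Γ : Type}

@[simp] def get (s : St Γ) : Reg → List Sym
  | .mem => s.mem
  | .left => s.left
  | .new => s.new

@[simp] def set (s : St Γ) : Reg → List Sym → St Γ
  | .mem, l => { s with mem := l }
  | .left, l => { s with left := l }
  | .new, l => { s with new := l }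

/-- The contents of the stacks. -/
def stk (s : St Γ) : ∀ k, List (Stk.Alph Γ k)
  | .inp => s.inp
  | .out => s.out
  | .reg r => s.get r
  | .ctr c => List.replicate (s.ctr c) ()

/-- The state with input `l`. -/
def init (l : List Γ) : St Γ := ⟨⟨none, false, false⟩, l, [], [], [], [], 0⟩

/-- The state with output `b`. -/
def final (b : Bool) : St Γ := ⟨⟨none, false, false⟩, [], [b], [], [], [], 0⟩

end St

/-- The primitive commands. -/
inductive Prim (Γ : Type)
  | read (f : Γ → Sym)
  | write
  | push (r : Reg) (f : Ctl → Sym)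
  | pop (r : Reg)
  | inc (c : Ctr)
  | dec (c : Ctr)
  | load (f : Ctl → Ctl)

namespace Prim

variable {Γ : Type}

/-- The effect of a primitive command. -/
@[simp] def run : Prim Γ → St Γ → St Γ
  | read f, s => { s with inp := s.inp.tail, top := s.inp.head?.map f }
  | write, s => { s with out := s.res :: s.out }
  | push r f, s => s.set r (f s.toCtl :: s.get r)
  | pop r, s => { s.set r (s.get r).tail with top := (s.get r).head? }
  | inc c, s => { s with ctr := update s.ctr c (s.ctr c + 1) }
  | dec c, s => { s with ctr := update s.ctr c (s.ctr c - 1), flag := decide (0 < s.ctr c) }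
  | load f, s => { s with toCtl := f s.toCtl }

/-- The Turing machine code of a primitive command. -/
def stmt {Λ : Type} (p : Prim Γ) (q : TM2.Stmt (Stk.Alph Γ) Λ Ctl) :
    TM2.Stmt (Stk.Alph Γ) Λ Ctl :=
  match p with
  | read f => .pop .inp (fun v (o : Option Γ) => { v with top := o.map f }) q
  | write => .push .out (fun v => v.res) q
  | push r f => .push (.reg r) f q
  | pop r => .pop (.reg r) (fun v (o : Option Sym) => { v with top := o }) q
  | inc c => .push (.ctr c) (fun _ => ()) q
  | dec c => .pop (.ctr c) (fun v (o : Option Unit) => { v with flag := o.isSome }) q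
  | load f => .load f q

/-- The record `St` is only another view of control and stacks, so the claim splits into one
equation for each, checked stack by stack. -/
theorem stepAux_stmt {Λ : Type} (p : Prim Γ) (q : TM2.Stmt (Stk.Alph Γ) Λ Ctl) (s : St Γ) :
    TM2.stepAux (p.stmt q) s.toCtl s.stk = TM2.stepAux q (p.run s).toCtl (p.run s).stk := by
  have key : ∀ {v v' : Ctl} {S S' : ∀ k, List (Stk.Alph Γ k)}, v = v' → S = S' →
      TM2.stepAux q v S = TM2.stepAux q v' S' := by rintro _ _ _ _ rfl rfl; rfl
  cases p with
  | read f =>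
    refine key rfl (funext fun k => ?_)
    cases k <;> rfl
  | write =>
    refine key rfl (funext fun k => ?_)
    cases k <;> rfl
  | push r f =>
    refine key (by cases r <;> rfl) (funext fun k => ?_)
    rcases k with _ | _ | k | k <;> cases r <;> try rfl
    all_goals cases k <;> rfl
  | pop r =>
    refine key (by cases r <;> rfl) (funext fun k => ?_)
    rcases k with _ | _ | k | k <;> cases r <;> try rfl
    all_goals cases k <;> rfl
  | inc c =>
    refine key rfl (funext fun k => ?_)
    rcases k with _ | _ | k | k <;> try rfl
    by_cases h : k = c
    · subst h
      refine (update_self _ _ _).trans ?_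
      change () :: List.replicate (s.ctr k) () =
        List.replicate (update s.ctr k (s.ctr k + 1) k) ()
      rw [update_self, List.replicate_succ]
    · simp [St.stk, h]
  | dec c =>
    refine key ?_ (funext fun k => ?_)
    · have : ∀ m, (List.replicate m ()).head?.isSome = decide (0 < m) := by
        rintro (_ | m) <;> simp [List.replicate_succ]
      exact Ctl.ext rfl (this (s.ctr c)) rfl
    rcases k with _ | _ | k | k <;> try rfl
    by_cases h : k = c
    · subst h
      refine (update_self _ _ _).trans ?_
      change (List.replicate (s.ctr k) ()).tail =
        List.replicate (update s.ctr k (s.ctr k - 1) k) ()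
      rw [update_self, List.tail_replicate]
    · simp [St.stk, h]
  | load f => exact key rfl rfl

end Prim

/-- The commands. -/
inductive Cmd (Γ : Type)
  | prim (p : Prim Γ)
  | seq (P Q : Cmd Γ)
  | ite (c : Ctl → Bool) (P Q : Cmd Γ)
  | loop (c : Ctl → Bool) (P : Cmd Γ)

variable {Γ : Type}

/-- `Exec P s s' t`: the command `P` leads from the state `s` to `s'` in `t` steps. -/
inductive Exec : Cmd Γ → St Γ → St Γ → ℕ → Prop
  | prim (p : Prim Γ) (s : St Γ) : Exec (.prim p) s (p.run s) 1
  | seq {P Q : Cmd Γ} {a b c : St Γ} {t u : ℕ} : Exec P a b t → Exec Q b c u →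
      Exec (.seq P Q) a c (t + u)
  | ite_true {c : Ctl → Bool} {P Q : Cmd Γ} {a b : St Γ} {t : ℕ} : c a.toCtl = true →
      Exec P a b t → Exec (.ite c P Q) a b (1 + t)
  | ite_false {c : Ctl → Bool} {P Q : Cmd Γ} {a b : St Γ} {t : ℕ} : c a.toCtl = false →
      Exec Q a b t → Exec (.ite c P Q) a b (1 + t)
  | loop_true {c : Ctl → Bool} {P : Cmd Γ} {a b d : St Γ} {t u : ℕ} : c a.toCtl = true →
      Exec P a b t → Exec (.loop c P) b d u → Exec (.loop c P) a d (1 + t + u)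
  | loop_false {c : Ctl → Bool} {P : Cmd Γ} {a : St Γ} : c a.toCtl = false →
      Exec (.loop c P) a a 1

/-! ### Compilation of commands into Turing machine code -/

namespace Cmd

/-- The labels of the code of a command. -/
def Lab : Cmd Γ → Type
  | prim _ => Unit
  | seq P Q => P.Lab ⊕ Q.Lab
  | ite _ P Q => Option (P.Lab ⊕ Q.Lab)
  | loop _ P => Option P.Lab

instance fintypeLab : (P : Cmd Γ) → Fintype P.Lab
  | prim _ => inferInstanceAs (Fintype Unit)
  | seq P Q => @instFintypeSum _ _ (fintypeLab P) (fintypeLab Q)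
  | ite _ P Q => @instFintypeOption _ (@instFintypeSum _ _ (fintypeLab P) (fintypeLab Q))
  | loop _ P => @instFintypeOption _ (fintypeLab P)

def entry : (P : Cmd Γ) → P.Lab
  | prim _ => ()
  | seq P _ => Sum.inl P.entry
  | ite _ _ _ => none
  | loop _ _ => none

/-- The code of a command that is continued by `q`. -/
def code {Λ : Type} : (P : Cmd Γ) → (P.Lab → Λ) → TM2.Stmt (Stk.Alph Γ) Λ Ctl →
    P.Lab → TM2.Stmt (Stk.Alph Γ) Λ Ctl
  | prim p, _, q, _ => p.stmt q
  | seq P Q, emb, q, l =>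
    match l with
    | .inl l => P.code (emb ∘ Sum.inl) (.goto fun _ => emb (.inr Q.entry)) l
    | .inr l => Q.code (emb ∘ Sum.inr) q l
  | ite c P Q, emb, q, l =>
    match l with
    | none => .branch c (.goto fun _ => emb (some (.inl P.entry)))
        (.goto fun _ => emb (some (.inr Q.entry)))
    | some (.inl l) => P.code (emb ∘ some ∘ Sum.inl) q l
    | some (.inr l) => Q.code (emb ∘ some ∘ Sum.inr) q l
  | loop c P, emb, q, l =>
    match l with
    | none => .branch c (.goto fun _ => emb (some P.entry)) q
    | some l => P.code (emb ∘ some) (.goto fun _ => emb none) l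

end Cmd

/-- Induction on the execution. The machine `M` and the embedding `emb` are arbitrary because the
code of a subcommand sits inside a larger program. The continuation `q` is run within the last of
the `t` machine steps, hence `TM2.stepAux q` on the right. -/
theorem Exec.iterate_step {P : Cmd Γ} {s s' : St Γ} {t : ℕ} (h : Exec P s s' t) {Λ : Type}
    (M : Λ → TM2.Stmt (Stk.Alph Γ) Λ Ctl) :
    ∀ (emb : P.Lab → Λ) (q : TM2.Stmt (Stk.Alph Γ) Λ Ctl),
      (∀ l, M (emb l) = P.code emb q l) →
      (flip bind (TM2.step M))^[t] (some ⟨some (emb P.entry), s.toCtl, s.stk⟩) =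
        some (TM2.stepAux q s'.toCtl s'.stk) := by
  have one : ∀ (l : Λ) (v : Ctl) (S : ∀ k, List (Stk.Alph Γ k)),
      (flip bind (TM2.step M)) (some ⟨some l, v, S⟩) = some (TM2.stepAux (M l) v S) := by
    intros; rfl
  induction h with
  | prim p s =>
    intro emb q hM
    rw [iterate_one, one, hM]
    exact congrArg some (p.stepAux_stmt q s)
  | @seq P Q a b c t u _ _ ih₁ ih₂ =>
    intro emb q hM
    rw [Nat.add_comm, iterate_add_apply]
    refine (congrArg _ (ih₁ (emb ∘ Sum.inl) _ fun l => hM (.inl l))).trans ?_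
    exact ih₂ (emb ∘ Sum.inr) q fun l => hM (.inr l)
  | @ite_true c P Q a b t hc _ ih =>
    intro emb q hM
    rw [Nat.add_comm, iterate_add_apply, iterate_one, one, hM]
    simp only [Cmd.entry, Cmd.code, TM2.stepAux, hc, cond_true]
    exact ih (emb ∘ some ∘ Sum.inl) q fun l => hM (some (.inl l))
  | @ite_false c P Q a b t hc _ ih =>
    intro emb q hM
    rw [Nat.add_comm, iterate_add_apply, iterate_one, one, hM]
    simp only [Cmd.entry, Cmd.code, TM2.stepAux, hc, cond_false]
    exact ih (emb ∘ some ∘ Sum.inr) q fun l => hM (some (.inr l))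
  | @loop_true c P a b d t u hc _ _ ih₁ ih₂ =>
    intro emb q hM
    rw [show 1 + t + u = u + (t + 1) by omega, iterate_add_apply, iterate_add_apply, iterate_one,
      one, hM]
    simp only [Cmd.entry, Cmd.code, TM2.stepAux, hc, cond_true]
    refine (congrArg _ (ih₁ (emb ∘ some) _ fun l => hM (some l))).trans ?_
    exact ih₂ emb q hM
  | @loop_false c P a hc =>
    intro emb q hM
    rw [iterate_one, one, hM]
    simp only [Cmd.entry, Cmd.code, TM2.stepAux, hc, cond_false]

/-- The Turing machine of a command. -/
def Cmd.machine [Fintype Γ] (P : Cmd Γ) : FinTM2 where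
  K := Stk
  k₀ := .inp
  k₁ := .out
  Γ := Stk.Alph Γ
  Λ := P.Lab
  main := P.entry
  σ := Ctl
  initialState := ⟨none, false, false⟩
  Γk₀Fin := inferInstanceAs (Fintype Γ)
  m := P.code id .halt

/-- The final state is prescribed completely because the halting configuration of a `FinTM2` has the
initial control state and all stacks empty except for the output. -/
theorem polyTimeDecidable_of_exec {α : Type} [Fintype Γ] (enc : α → List Γ) (Q : α → Prop)
    (P : Cmd Γ) (p : Polynomial ℕ)
    (h : ∀ a, ∃ b : Bool, (b = true ↔ Q a) ∧
      ∃ t ≤ p.eval (enc a).length, Exec P (St.init (enc a)) (St.final b) t) :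
    Complexity.PolyTimeDecidable enc Q := by
  classical
  refine ⟨{ tm := P.machine, inputAlphabet := Equiv.refl Γ, outputAlphabet := Equiv.refl Bool,
            time := p, outputsFun := fun a => Classical.choice ?_ }⟩
  obtain ⟨b, hb, t, ht, he⟩ := h a
  have hb' : decide (Q a) = b := by
    cases b <;> simpa using hb
  refine ⟨⟨⟨t, ?_⟩, ht⟩⟩
  have := he.iterate_step (P.code id .halt) id .halt fun _ => rfl
  refine Eq.trans ?_ (this.trans ?_)
  · refine congrArg _ (congrArg some ?_)
    simp only [initList]
    refine congrArg₂ _ rfl (funext fun k => ?_)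
    cases k
    · exact (dif_pos rfl).trans (List.map_id _)
    · rfl
    · rename_i r
      cases r <;> rfl
    · rfl
  · simp only [Option.map_some, haltList, TM2.stepAux]
    refine congrArg some (congrArg₂ _ rfl (funext fun k => ?_))
    rcases k with _ | _ | k | k
    · rfl
    · simp [Cmd.machine, St.stk, St.final, Computability.encodeBool, hb']
      rfl
    · cases k <;> rfl
    · rfl

end StackMachine
end

noncomputable section

namespace StackMachine

open Function

variable {Γ : Type}

/-! ### Execution within a time bound -/

/-- The command `P` leads from `s` to `s'` within `T` steps. -/
def Ex (P : Cmd Γ) (s s' : St Γ) (T : ℕ) : Prop := ∃ t ≤ T, Exec P s s' t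

namespace Ex

variable {P Q : Cmd Γ} {a b d : St Γ} {T U : ℕ} {c : Ctl → Bool}

theorem mono (h : Ex P a b T) (hTU : T ≤ U) : Ex P a b U :=
  let ⟨t, ht, he⟩ := h
  ⟨t, ht.trans hTU, he⟩

theorem congr {b' : St Γ} (h : Ex P a b T) (hb : b = b') : Ex P a b' T := hb ▸ h

theorem prim (p : Prim Γ) (s : St Γ) : Ex (.prim p) s (p.run s) 1 := ⟨1, le_rfl, .prim p s⟩

theorem prim_eq {p : Prim Γ} (h : p.run a = b) : Ex (.prim p) a b 1 := h ▸ prim p a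

theorem seq (h₁ : Ex P a b T) (h₂ : Ex Q b d U) : Ex (.seq P Q) a d (T + U) :=
  let ⟨t, ht, he⟩ := h₁
  let ⟨u, hu, hf⟩ := h₂
  ⟨t + u, by omega, .seq he hf⟩

theorem ite_true (hc : c a.toCtl = true) (h : Ex P a b T) : Ex (.ite c P Q) a b (T + 1) :=
  let ⟨t, ht, he⟩ := h
  ⟨1 + t, by omega, .ite_true hc he⟩

theorem ite_false (hc : c a.toCtl = false) (h : Ex Q a b T) : Ex (.ite c P Q) a b (T + 1) :=
  let ⟨t, ht, he⟩ := h
  ⟨1 + t, by omega, .ite_false hc he⟩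

theorem loop_true (hc : c a.toCtl = true) (h₁ : Ex P a b T) (h₂ : Ex (.loop c P) b d U) :
    Ex (.loop c P) a d (T + U + 1) :=
  let ⟨t, ht, he⟩ := h₁
  let ⟨u, hu, hf⟩ := h₂
  ⟨1 + t + u, by omega, .loop_true hc he hf⟩

theorem loop_false (hc : c a.toCtl = false) : Ex (.loop c P) a a 1 := ⟨1, le_rfl, .loop_false hc⟩

end Ex

/-! ### Loops over counters -/

namespace Cmd

/-- Do nothing. -/
def nop : Cmd Γ := .prim (.load id)

/-- Reset the control, except for the result. -/
def reset : Cmd Γ := .prim (.load fun v => ⟨none, false, v.res⟩)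

/-- Repeat `P` as often as the counter `c` tells, with `t` counting the repetitions. -/
def forEach (c t : Ctr) (P : Cmd Γ) : Cmd Γ :=
  .seq (.prim (.dec c)) <| .seq
    (.loop Ctl.flag <| .seq (.prim (.load fun v => { v with flag := false })) <|
      .seq P <| .seq (.prim (.inc t)) (.prim (.dec c))) <|
    .seq (.prim (.dec t)) (.loop Ctl.flag <| .seq (.prim (.inc c)) (.prim (.dec t)))

end Cmd

namespace St

/-- Set the flag. -/
def setFlag (s : St Γ) (b : Bool) : St Γ := { s with flag := b }

theorem setFlag_self {s : St Γ} {b : Bool} (h : s.flag = b) : s.setFlag b = s := by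
  subst h; rfl

/-- Set two counters. -/
def setCtr (s : St Γ) (c t : Ctr) (a b : ℕ) : St Γ :=
  { s with ctr := update (update s.ctr c a) t b }

theorem setCtr_self {s : St Γ} {c t : Ctr} {a b : ℕ} (hc : s.ctr c = a) (ht : s.ctr t = b) :
    s.setCtr c t a b = s := by
  subst hc ht
  simp [setCtr]

end St

/-! ### Running time of counted loops -/

section forEach

variable {c t : Ctr}

theorem run_inc_right (s : St Γ) (a b : ℕ) :
    (Prim.inc t).run (s.setCtr c t a b) = s.setCtr c t a (b + 1) := by
  simp [St.setCtr]

theorem run_inc_left (hct : c ≠ t) (s : St Γ) (a b : ℕ) :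
    (Prim.inc c).run (s.setCtr c t a b) = s.setCtr c t (a + 1) b := by
  simp [St.setCtr, update_comm hct]

theorem run_dec_right (s : St Γ) (a b : ℕ) :
    (Prim.dec t).run (s.setCtr c t a b) =
      (s.setCtr c t a (b - 1)).setFlag (decide (0 < b)) := by
  simp [St.setCtr, St.setFlag]

theorem run_dec_left (hct : c ≠ t) (s : St Γ) (a b : ℕ) :
    (Prim.dec c).run (s.setCtr c t a b) =
      (s.setCtr c t (a - 1) b).setFlag (decide (0 < a)) := by
  simp [St.setCtr, St.setFlag, update_comm hct]

/-- The family `st` is the loop invariant. In round `j` the body sees `t = j` and `c = h - 1 - j`,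
since `c` has already been decremented; a second loop then moves `t` back to `c`. A round costs `T +
4` on the way up and `3` on the way down. -/
theorem Ex.forEach {P : Cmd Γ} {T h : ℕ} (hct : c ≠ t) (st : ℕ → St Γ)
    (hflag : ∀ j ≤ h, (st j).flag = false)
    (hP : ∀ j < h, Ex P ((st j).setCtr c t (h - 1 - j) j) ((st (j + 1)).setCtr c t (h - 1 - j) j) T) :
    Ex (.forEach c t P) ((st 0).setCtr c t h 0) ((st h).setCtr c t h 0) (h * (T + 7) + 4) := by
  -- The test of the loop comes after a decrement: `r` rounds are left, the counter shows `r - 1`,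
  -- and the flag tells whether `r` was positive.
  have up : ∀ r j, j + r = h →
      Ex (.loop Ctl.flag <| .seq (.prim (.load fun v => { v with flag := false })) <|
        .seq P <| .seq (.prim (.inc t)) (.prim (.dec c)))
        (((st j).setCtr c t (r - 1) j).setFlag (decide (0 < r)))
        (((st h).setCtr c t 0 h).setFlag false) (r * (T + 4) + 1) := by
    intro r
    induction r with
    | zero =>
      rintro j rfl
      exact (Ex.loop_false rfl).mono (by omega)
    | succ r ih =>
      intro j hj
      have h1 := hP j (by omega)
      rw [show h - 1 - j = r by omega] at h1
      refine (Ex.loop_true rfl ((Ex.prim_eq ?_).seq (h1.seq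
        ((Ex.prim_eq (run_inc_right ..)).seq (Ex.prim_eq (run_dec_left hct ..)))))
        (ih (j + 1) (by omega))).mono (le_of_eq (by ring))
      have := hflag j (by omega)
      simp [St.setCtr, St.setFlag, ← this]
  have down : ∀ b a, a + b = h →
      Ex (.loop Ctl.flag <| .seq (.prim (.inc c)) (.prim (.dec t)))
        (((st h).setCtr c t a (b - 1)).setFlag (decide (0 < b)))
        ((st h).setCtr c t h 0) (b * 3 + 1) := by
    intro b
    induction b with
    | zero =>
      rintro a rfl
      have := hflag _ le_rfl
      have h0 : ((st (a + 0)).setCtr c t a (0 - 1)).setFlag (decide (0 < 0)) =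
          (st (a + 0)).setCtr c t (a + 0) 0 := St.setFlag_self this
      rw [h0]
      exact Ex.loop_false (a := (st (a + 0)).setCtr c t (a + 0) 0) this
    | succ b ih =>
      intro a ha
      refine (Ex.loop_true rfl ((Ex.prim_eq (b := ((st h).setCtr c t (a + 1) b).setFlag true)
        ?_).seq (Ex.prim_eq ?_)) (ih (a + 1) (by omega))).mono (le_of_eq (by ring))
      · rw [← run_inc_left hct]
        rfl
      · rw [← run_dec_right]
        rfl
  refine ((Ex.prim_eq (run_dec_left hct ..)).seq ((up h 0 (by omega)).seq
    ((Ex.prim_eq ?_).seq (down h 0 (by omega))))).mono (le_of_eq (by ring))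
  rw [← run_dec_right]
  rfl

/-- A loop over a counter whose value is kept by the body. -/
theorem Ex.forEach_of_frame {P : Cmd Γ} {T h : ℕ} (hct : c ≠ t) (st : ℕ → St Γ)
    (hflag : ∀ j, (st j).flag = false) (hc : ∀ j, (st j).ctr c = h) (ht : ∀ j, (st j).ctr t = 0)
    (hP : ∀ j < h, ∀ a b, Ex P ((st j).setCtr c t a b) ((st (j + 1)).setCtr c t a b) T) :
    Ex (.forEach c t P) (st 0) (st h) (h * (T + 7) + 4) := by
  have := Ex.forEach hct st (h := h) (fun j _ => hflag j) fun j hj => hP j hj _ _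
  rwa [St.setCtr_self (hc _) (ht _), St.setCtr_self (hc _) (ht _)] at this

end forEach

/-! ### Reading the memory -/

namespace Cmd

/-- Move one symbol from `mem` to `left`. -/
def move : Cmd Γ :=
  .seq (.prim (.pop .mem)) <| .seq
    (.ite (fun v => v.top.isSome) (.prim (.push .left fun v => v.top.getD none)) nop) reset

/-- Pour the stack `r` over `mem`. -/
def pour (r : Reg) : Cmd Γ :=
  .seq (.prim (.pop r)) <| .loop (fun v => v.top.isSome) <|
    .seq (.prim (.push .mem fun v => v.top.getD none)) (.prim (.pop r))

/-- Move the symbols up to the first separator from `mem` to `left`. -/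
def moveSep : Cmd Γ :=
  .seq (.prim (.pop .mem)) <| .seq
    (.loop (fun v => v.top.any Option.isSome) <|
      .seq (.prim (.push .left fun v => v.top.getD none)) (.prim (.pop .mem))) <|
    .seq (.ite (fun v => v.top.isSome) (.prim (.push .left fun v => v.top.getD none)) nop) reset

end Cmd

namespace St

/-- Move `k` symbols from `mem` to `left`. -/
def adv (s : St Γ) (k : ℕ) : St Γ :=
  { s with mem := s.mem.drop k, left := (s.mem.take k).reverse ++ s.left }

theorem adv_zero (s : St Γ) : s.adv 0 = s := by simp [adv]

theorem adv_adv (s : St Γ) (j k : ℕ) : (s.adv j).adv k = s.adv (j + k) := by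
  simp [adv, List.take_add, List.drop_drop]

end St

theorem ex_move {s : St Γ} (htop : s.top = none) (hflag : s.flag = false) :
    Ex .move s (s.adv 1) 4 := by
  rcases s with ⟨⟨top, flag, res⟩, inp, out, mem, left, new, ctr⟩
  obtain rfl : top = none := htop
  obtain rfl : flag = false := hflag
  rcases mem with _ | ⟨x, mem⟩
  · exact (Ex.prim _ _).seq ((Ex.ite_false rfl (Ex.prim _ _)).seq (Ex.prim _ _))
  · exact (Ex.prim _ _).seq ((Ex.ite_true rfl (Ex.prim _ _)).seq (Ex.prim _ _))

theorem ex_pour {s : St Γ} {r : Reg} (hr : r ≠ .mem) (htop : s.top = none) :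
    Ex (.pour r) s ({ s with mem := (s.get r).reverse ++ s.mem }.set r [])
      ((s.get r).length * 3 + 2) := by
  -- Inside the loop the unread word `l` is split between the control, which holds its head, and the
  -- stack, which holds its tail.
  have key : ∀ (l : List Sym) (s : St Γ), s.top = l.head? → s.get r = l.tail →
      Ex (.loop (fun v => v.top.isSome) <|
        .seq (.prim (.push .mem fun v => v.top.getD none)) (.prim (.pop r))) s
        ({ s with mem := l.reverse ++ s.mem, top := none }.set r []) (l.length * 3 + 1) := by
    intro l
    induction l with
    | nil =>
      intro s h1 h2
      rcases s with ⟨⟨top, flag, res⟩, inp, out, mem, left, new, ctr⟩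
      obtain rfl : top = none := h1
      refine ((Ex.loop_false rfl).congr ?_).mono (by simp)
      cases r <;> first | exact absurd rfl hr | (simp at h2; simp [h2])
    | cons x l ih =>
      intro s h1 h2
      rcases s with ⟨⟨top, flag, res⟩, inp, out, mem, left, new, ctr⟩
      obtain rfl : top = some x := h1
      have := ih ((Prim.pop r).run ((Prim.push .mem fun v => v.top.getD none).run
        ⟨⟨some x, flag, res⟩, inp, out, mem, left, new, ctr⟩))
        (by cases r <;> first | exact absurd rfl hr | (simp at h2; simp [h2]))
        (by cases r <;> first | exact absurd rfl hr | (simp at h2; simp [h2]))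
      refine ((Ex.loop_true rfl ((Ex.prim _ _).seq (Ex.prim _ _)) this).congr ?_).mono
        (by simp; omega)
      cases r <;> first | exact absurd rfl hr | simp
  have := key (s.get r) ((Prim.pop r).run s) (by cases r <;> rfl) (by cases r <;> rfl)
  refine (((Ex.prim _ _).seq this).congr ?_).mono (le_of_eq (by ring))
  rcases s with ⟨⟨top, flag, res⟩, inp, out, mem, left, new, ctr⟩
  obtain rfl : top = none := htop
  cases r <;> first | exact absurd rfl hr | simp

theorem ex_moveSep {s : St Γ} (htop : s.top = none) (hflag : s.flag = false) :
    Ex .moveSep s (s.adv ((s.mem.takeWhile Option.isSome).length + 1))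
      (s.mem.length * 3 + 5) := by
  rcases s with ⟨⟨top, flag, res⟩, inp, out, mem, left, new, ctr⟩
  obtain rfl : top = none := htop
  obtain rfl : flag = false := hflag
  -- The ending is included after the loop, since only then is the state described uniformly,
  -- whether or not a separator is found.
  have key : ∀ (l left : List Sym),
      Ex (.seq (.loop (fun v => v.top.any Option.isSome) <|
        .seq (.prim (.push .left fun v => v.top.getD none)) (.prim (.pop .mem))) <|
        .seq (.ite (fun v => v.top.isSome) (.prim (.push .left fun v => v.top.getD none)) .nop)
          .reset)
        (⟨⟨l.head?, false, res⟩, inp, out, l.tail, left, new, ctr⟩ : St Γ)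
        ((⟨⟨none, false, res⟩, inp, out, l, left, new, ctr⟩ : St Γ).adv
          ((l.takeWhile Option.isSome).length + 1))
        (l.length * 3 + 4) := by
    intro l
    induction l with
    | nil =>
      intro left
      exact ((Ex.loop_false rfl).seq ((Ex.ite_false rfl (Ex.prim _ _)).seq (Ex.prim _ _)))
    | cons x l ih =>
      intro left
      cases x with
      | none =>
        exact ((Ex.loop_false rfl).seq
          ((Ex.ite_true rfl (Ex.prim _ _)).seq (Ex.prim _ _))).mono (by simp)
      | some x =>
        -- The execution from the induction hypothesis is taken apart into loop and ending, so that
        -- one more round can be put in front of the loop.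
        obtain ⟨t, ht, he⟩ := ih (some x :: left)
        cases he with
        | seq h1 h2 =>
          rename_i d t u
          have h3 := Exec.seq (Exec.loop_true (c := fun v => v.top.any Option.isSome)
            (a := ⟨⟨some (some x), false, res⟩, inp, out, l, left, new, ctr⟩) rfl
            (Exec.seq (Exec.prim (.push .left fun v => v.top.getD none) _)
              (Exec.prim (.pop .mem) _)) h1) h2
          refine Ex.congr ⟨_, ?_, h3⟩ ?_
          · simp; omega
          · simp [St.adv]
  exact ((Ex.prim _ _).seq (key mem left)).mono (by simp; omega)

end StackMachine
end

noncomputable section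

namespace StackMachine

open Function

variable {Γ : Type}

/-! ### First-order queries -/

/-- The steps of an address: one symbol, as many symbols as the length parameter `n`, as the value
`a` of a variable or as `n * a` tells, or all symbols up to the first separator. -/
inductive Skip
  | one | num
  | var (i : Fin 4)
  | row (i : Fin 4)
  | sep

namespace Skip

def len (n : ℕ) (ρ : Fin 4 → ℕ) (l : List Sym) : Skip → ℕ
  | one => 1
  | num => n
  | var i => ρ i
  | row i => ρ i * n
  | sep => (l.takeWhile Option.isSome).length + 1

def cmd : Skip → Cmd Γ
  | one => .move
  | num => .forEach .num .tmp .move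
  | var i => .forEach (.val i) .tmp .move
  | row i => .forEach (.val i) .tmp' (.forEach .num .tmp .move)
  | sep => .moveSep

/-- The total length of the steps `t` in the word `l`. -/
def offset (n : ℕ) (ρ : Fin 4 → ℕ) : List Sym → List Skip → ℕ
  | _, [] => 0
  | l, k :: t => k.len n ρ l + offset n ρ (l.drop (k.len n ρ l)) t

def cmds : List Skip → Cmd Γ
  | [] => .nop
  | k :: t => .seq k.cmd (cmds t)

end Skip

namespace St

/-- The values of the variables. -/
def env (s : St Γ) : Fin 4 → ℕ := fun i => s.ctr (.val i)

/-- The state `s` is ready for reading the memory, with the length parameter `n` and the size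
bound `B`. -/
structure Ready (s : St Γ) (n B : ℕ) : Prop where
  top : s.top = none
  flag : s.flag = false
  num : s.ctr .num = n
  tmp : s.ctr .tmp = 0
  tmp' : s.ctr .tmp' = 0
  val : ∀ i, s.ctr (.val i) ≤ B
  le : n ≤ B
  length : s.mem.length ≤ B

theorem Ready.adv {s : St Γ} {n B : ℕ} (h : s.Ready n B) (k : ℕ) : (s.adv k).Ready n B :=
  ⟨h.top, h.flag, h.num, h.tmp, h.tmp', h.val, h.le, by
    have := h.length
    simp only [St.adv, List.length_drop]
    omega⟩

end St

open St

theorem ex_forEach_move {s : St Γ} {c t : Ctr} {h : ℕ} (hct : c ≠ t) (htop : s.top = none)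
    (hflag : s.flag = false) (hc : s.ctr c = h) (ht : s.ctr t = 0) :
    Ex (.forEach c t .move) s (s.adv h) (h * 11 + 4) := by
  have := Ex.forEach_of_frame (P := .move) (T := 4) hct (fun j => s.adv j) (fun _ => hflag)
    (fun _ => hc) (fun _ => ht) fun j _ a b => by
      rw [← adv_adv]
      exact ex_move (s := (s.adv j).setCtr c t a b) htop hflag
  simpa only [adv_zero] using this

/-- Only `row` needs quadratic time. It is a nested loop, which is why there are two scratch
counters `tmp` and `tmp'`. -/
theorem ex_skip {s : St Γ} {n B : ℕ} (h : s.Ready n B) (k : Skip) :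
    Ex k.cmd s (s.adv (k.len n s.env s.mem)) (20 * (B + 1) ^ 2) := by
  have hn := h.le
  cases k with
  | one => exact (ex_move h.top h.flag).mono (by nlinarith)
  | num => exact (ex_forEach_move (by simp) h.top h.flag h.num h.tmp).mono (by nlinarith)
  | var i =>
    have := h.val i
    exact (ex_forEach_move (by simp) h.top h.flag rfl h.tmp).mono (by nlinarith)
  | row i =>
    have := h.val i
    have := Ex.forEach_of_frame (P := .forEach .num .tmp .move) (T := n * 11 + 4)
      (c := .val i) (t := .tmp') (by simp) (fun j => s.adv (j * n)) (fun _ => h.flag)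
      (fun _ => rfl) (fun _ => h.tmp') fun j _ a b => by
        rw [add_mul, one_mul, ← adv_adv]
        refine ex_forEach_move (s := (s.adv (j * n)).setCtr (.val i) .tmp' a b) (by simp)
          h.top h.flag ?_ ?_
        · exact h.num
        · exact h.tmp
    simp only [zero_mul, adv_zero] at this
    refine this.mono ?_
    have : s.ctr (.val i) * (n * 11 + 4 + 7) ≤ B * (B * 11 + 4 + 7) := by
      have := h.val i
      gcongr
    nlinarith
  | sep =>
    have := h.length
    exact (ex_moveSep h.top h.flag).mono (by nlinarith)

theorem ex_cmds (t : List Skip) : ∀ {s : St Γ} {n B : ℕ}, s.Ready n B →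
    Ex (Skip.cmds t) s (s.adv (Skip.offset n s.env s.mem t)) (t.length * (20 * (B + 1) ^ 2) + 1) := by
  induction t with
  | nil =>
    intro s n B h
    simp only [Skip.offset, adv_zero, List.length_nil, zero_mul, zero_add]
    exact Ex.prim _ _
  | cons k t ih =>
    intro s n B h
    refine (((ex_skip h k).seq (ih (h.adv _))).congr ?_).mono (le_of_eq ?_)
    · rw [adv_adv]
      rfl
    · simp only [List.length_cons]
      ring

/-- First-order formulas about a word. The quantifier ranges over the numbers below the length
parameter. -/
inductive Fml
  | sym (c : Sym) (t : List Skip)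
  | neg (φ : Fml)
  | and (φ ψ : Fml)
  | ex (i : Fin 4) (φ : Fml)

namespace Fml

def eval (n : ℕ) (l : List Sym) : Fml → (Fin 4 → ℕ) → Prop
  | sym c t, ρ => (l.drop (Skip.offset n ρ l t)).head? = some c
  | neg φ, ρ => ¬ φ.eval n l ρ
  | and φ ψ, ρ => φ.eval n l ρ ∧ ψ.eval n l ρ
  | ex i φ, ρ => ∃ a < n, φ.eval n l (update ρ i a)

/-- No variable is bound twice, and those in `U` are not bound at all. -/
def wellScoped : Fml → List (Fin 4) → Bool
  | sym _ _, _ => true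
  | neg φ, U => φ.wellScoped U
  | and φ ψ, U => φ.wellScoped U && ψ.wellScoped U
  | ex i φ, U => !U.contains i && φ.wellScoped (i :: U)

/-- An atom walks to its address by moving symbols to `left`, looks at one symbol and pours
everything back, so the memory is preserved. In a quantifier the counter of the completed rounds is
`val i` itself and thus serves as the value of the bound variable; after a witness has been found
the remaining rounds are idle. -/
def cmd : Fml → Cmd Γ
  | sym c t => .seq (Skip.cmds t) <| .seq (.prim (.pop .mem)) <|
      .seq (.prim (.load fun v => { v with res := v.top == some c })) <|
      .seq (.ite (fun v => v.top.isSome) (.prim (.push .mem fun v => v.top.getD none)) .nop) <|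
      .seq .reset (.pour .left)
  | neg φ => .seq φ.cmd (.prim (.load fun v => { v with res := !v.res }))
  | and φ ψ => .seq φ.cmd (.ite Ctl.res ψ.cmd .nop)
  | ex i φ => .seq (.prim (.load fun v => { v with res := false })) <|
      .forEach (.rem i) (.val i) (.ite Ctl.res .nop φ.cmd)

/-- A bound for the running time; the variable stands for the size of the memory. -/
def cost : Fml → Polynomial ℕ
  | sym _ t => (t.length + 1 : ℕ) * (20 * (.X + 1) ^ 2)
  | neg φ => φ.cost + 1
  | and φ ψ => φ.cost + ψ.cost + 2
  | ex _ φ => .X * (φ.cost + 9) + 5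

end Fml

namespace St

/-- The state `s` is ready for the evaluation of a formula in which the variables in `U` are
free. -/
structure Good (s : St Γ) (n B : ℕ) (U : List (Fin 4)) : Prop extends s.Ready n B where
  left : s.left = []
  val_eq : ∀ i ∉ U, s.ctr (.val i) = 0
  rem_eq : ∀ i ∉ U, s.ctr (.rem i) = n

/-- Set the result. -/
def setRes (s : St Γ) (b : Bool) : St Γ := { s with res := b }

theorem Good.setRes {s : St Γ} {n B : ℕ} {U : List (Fin 4)} (h : s.Good n B U) (b : Bool) :
    (s.setRes b).Good n B U :=
  ⟨⟨h.top, h.flag, h.num, h.tmp, h.tmp', h.val, h.le, h.length⟩, h.left, h.val_eq, h.rem_eq⟩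

theorem Good.bind {s : St Γ} {n B a b : ℕ} {U : List (Fin 4)} (h : s.Good n B U) (i : Fin 4)
    (hb : b ≤ B) : (s.setCtr (.rem i) (.val i) a b).Good n B (i :: U) := by
  refine ⟨⟨h.top, h.flag, ?_, ?_, ?_, fun k => ?_, h.le, h.length⟩, h.left, fun k hk => ?_,
    fun k hk => ?_⟩
  · simpa [St.setCtr] using h.num
  · simpa [St.setCtr] using h.tmp
  · simpa [St.setCtr] using h.tmp'
  · by_cases hki : k = i
    · subst hki
      simpa [St.setCtr] using hb
    · simpa [St.setCtr, hki] using h.val k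
  · simp only [List.mem_cons, not_or] at hk
    simpa [St.setCtr, hk.1] using h.val_eq k hk.2
  · simp only [List.mem_cons, not_or] at hk
    simpa [St.setCtr, hk.1] using h.rem_eq k hk.2

theorem env_setCtr (s : St Γ) (i : Fin 4) (a b : ℕ) :
    (s.setCtr (.rem i) (.val i) a b).env = update s.env i b := by
  funext k
  by_cases hk : k = i
  · subst hk
    simp [env, setCtr]
  · simp [env, setCtr, hk]

end St

/-- Induction on `φ`; evaluation changes nothing but `res`, so evaluations can be chained. Scoping
guarantees that the counters of a variable are at `n` and `0` when its quantifier is entered. -/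
theorem ex_fml (φ : Fml) : ∀ {s : St Γ} {n B : ℕ} {U : List (Fin 4)}, φ.wellScoped U = true →
    s.Good n B U → ∀ b : Bool, (b = true ↔ φ.eval n s.mem s.env) →
    Ex φ.cmd s (s.setRes b) (φ.cost.eval B) := by
  induction φ with
  | sym c t =>
    intro s n B U _ h b hb
    -- The part after the walk, for an arbitrary offset `k`: inspect the symbol, push it back and
    -- restore the memory.
    have key : ∀ k, (b = true ↔ (s.mem.drop k).head? = some c) →
        Ex (.seq (.prim (.pop .mem)) <|
        .seq (.prim (.load fun v => { v with res := v.top == some c })) <|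
        .seq (.ite (fun v => v.top.isSome) (.prim (.push .mem fun v => v.top.getD none)) .nop) <|
        .seq .reset (.pour .left))
        (s.adv k) (s.setRes b) (s.mem.length * 3 + 7) := by
      obtain ⟨⟨h1, h2, _, _, _, _, _, _⟩, h4, _, _⟩ := h
      intro k hk
      clear hb
      rcases s with ⟨⟨top, flag, res⟩, inp, out, mem, left, new, ctr⟩
      obtain rfl : top = none := h1
      obtain rfl : flag = false := h2
      obtain rfl : left = [] := h4
      have hpour : ∀ b, Ex (.pour .left)
          (⟨⟨none, false, b⟩, inp, out, mem.drop k, (mem.take k).reverse, new, ctr⟩ : St Γ)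
          ⟨⟨none, false, b⟩, inp, out, mem, [], new, ctr⟩ (mem.length * 3 + 2) := fun b =>
        ((ex_pour (by simp) rfl).congr (by simp)).mono (by simp)
      rcases hd : mem.drop k with _ | ⟨x, l⟩
      · rw [hd] at hpour
        simp only [hd] at hk
        obtain rfl : b = false := by simpa using hk
        simp only [St.adv, hd, List.append_nil]
        exact ((Ex.prim _ _).seq ((Ex.prim _ _).seq ((Ex.ite_false rfl (Ex.prim _ _)).seq
          ((Ex.prim _ _).seq (hpour false))))).mono (by omega)
      · rw [hd] at hpour
        simp only [hd] at hk
        have hx : b = (some x == some c) := by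
          rw [Bool.eq_iff_iff, hk]
          simp
        simp only [St.adv, hd, List.append_nil, hx]
        exact ((Ex.prim _ _).seq ((Ex.prim _ _).seq ((Ex.ite_true rfl (Ex.prim _ _)).seq
          ((Ex.prim _ _).seq (hpour _))))).mono (by omega)
    refine ((ex_cmds t h.toReady).seq (key _ hb)).mono ?_
    have := h.length
    simp only [Fml.cost, Polynomial.eval_mul, Polynomial.eval_natCast, Polynomial.eval_pow,
      Polynomial.eval_add, Polynomial.eval_X, Polynomial.eval_one, Polynomial.eval_ofNat,
      Nat.cast_id]
    nlinarith
  | neg φ ih =>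
    intro s n B U hU h b hb
    refine (((ih hU h (!b) ?_).seq (Ex.prim _ _)).congr ?_).mono ?_
    · simp only [Fml.eval] at hb
      cases b <;> simpa using hb
    · simp [St.setRes]
    · simp [Fml.cost]
  | and φ ψ ih₁ ih₂ =>
    intro s n B U hU h b hb
    simp only [Fml.wellScoped, Bool.and_eq_true] at hU
    simp only [Fml.eval] at hb
    by_cases hφ : φ.eval n s.mem s.env
    · simp only [hφ, true_and] at hb
      refine (((ih₁ hU.1 h true (by simpa)).seq (Ex.ite_true rfl
        (ih₂ hU.2 (h.setRes true) b hb))).congr ?_).mono ?_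
      · simp [St.setRes]
      · simp [Fml.cost]
        omega
    · obtain rfl : b = false := by simpa [hφ] using hb
      refine (((ih₁ hU.1 h false (by simpa)).seq (Ex.ite_false rfl (Ex.prim _ _))).congr ?_).mono ?_
      · simp [St.setRes]
      · simp [Fml.cost]
  | ex i φ ih =>
    intro s n B U hU h b hb
    classical
    simp only [Fml.wellScoped, Bool.and_eq_true, Bool.not_eq_true', List.contains_eq_mem,
      decide_eq_false_iff_not] at hU
    -- Invariant: after `j` rounds `res` tells whether there is a witness below `j`.
    have hloop := Ex.forEach (P := .ite Ctl.res .nop φ.cmd) (c := .rem i) (t := .val i)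
      (T := φ.cost.eval B + 2) (h := n) (by simp)
      (fun j => s.setRes (decide (∃ a < j, φ.eval n s.mem (update s.env i a))))
      (fun _ _ => h.flag) fun j hj => by
        by_cases hex : ∃ a < j, φ.eval n s.mem (update s.env i a)
        · have hex' : ∃ a < j + 1, φ.eval n s.mem (update s.env i a) :=
            hex.imp fun a ha => ⟨by omega, ha.2⟩
          rw [decide_eq_true hex, decide_eq_true hex']
          exact (Ex.ite_true rfl (Ex.prim _ _)).mono (by omega)
        · have hiff : (∃ a < j + 1, φ.eval n s.mem (update s.env i a)) ↔
              φ.eval n s.mem (update s.env i j) := by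
            refine ⟨fun ⟨a, ha, he⟩ => ?_, fun he => ⟨j, by omega, he⟩⟩
            rcases Nat.lt_succ_iff_lt_or_eq.1 ha with ha | rfl
            · exact absurd ⟨a, ha, he⟩ hex
            · exact he
          rw [decide_eq_false hex]
          have hB := hj.le.trans h.le
          have := ih hU.2 ((h.setRes false).bind i (a := n - 1 - j) (b := j) hB)
            (decide (∃ a < j + 1, φ.eval n s.mem (update s.env i a))) (by
              rw [env_setCtr, decide_eq_true_iff, hiff]
              rfl)
          exact (Ex.ite_false rfl this).mono (by omega)
    have hself : ∀ b, (s.setRes b).setCtr (.rem i) (.val i) n 0 = s.setRes b := fun b =>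
      St.setCtr_self (h.rem_eq i hU.1) (h.val_eq i hU.1)
    have hb' : decide (∃ a < n, φ.eval n s.mem (update s.env i a)) = b := by
      rw [Bool.eq_iff_iff, hb, decide_eq_true_iff]
      rfl
    simp only [hself, hb'] at hloop
    refine (Ex.seq (Ex.prim _ _) hloop).mono ?_
    have hn := h.le
    simp only [Fml.cost, Polynomial.eval_mul, Polynomial.eval_add, Polynomial.eval_X,
      Polynomial.eval_ofNat]
    have : n * (φ.cost.eval B + 2 + 7) ≤ B * (φ.cost.eval B + 9) := by gcongr
    omega

end StackMachine
end

noncomputable section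

namespace StackMachine

open Function

variable {Γ : Type}

/-! ### Queries with fixed points -/

/-- A sequence of unary inductive definitions, followed by a formula. The bits of a relation that
has been defined are put in front of the word. -/
inductive Query
  | ret (φ : Fml)
  | fix (φ : Fml) (q : Query)

open Classical in
/-- One round of the inductive definition by `φ`, in which the element is the variable `0`. -/
def Fml.round (φ : Fml) (n : ℕ) (l X : List Sym) : List Sym :=
  (List.range n).map fun a => some (decide (φ.eval n (X ++ l) (update 0 0 a)))

namespace Query

/-- The inductive definition starts from the empty relation; for a monotone operator on an
`n`-element set, `n` rounds reach the least fixed point. -/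
def eval (n : ℕ) : Query → List Sym → Prop
  | ret φ, l => φ.eval n l 0
  | fix φ q, l => q.eval n ((φ.round n l)^[n] (List.replicate n (some false)) ++ l)

def wellScoped : Query → Bool
  | ret φ => φ.wellScoped []
  | fix φ q => φ.wellScoped [0] && q.wellScoped

def depth : Query → ℕ
  | ret _ => 0
  | fix _ q => q.depth + 1

/-- The commands that replace the relation in front of the memory by the next one. -/
def roundCmd (φ : Fml) : Cmd Γ :=
  .seq (.forEach (.rem 0) (.val 0) <| .seq φ.cmd <|
    .seq (.prim (.push .new fun v => some v.res)) (.prim (.load fun v => { v with res := false }))) <|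
  .seq (.forEach .num .tmp <| .seq (.prim (.pop .mem)) .reset) (.pour .new)

def cmd : Query → Cmd Γ
  | ret φ => φ.cmd
  | fix φ q => .seq (.forEach .num .tmp (.prim (.push .mem fun _ => some false))) <|
      .seq (.forEach .iter .iter' (roundCmd φ)) q.cmd

def cost : Query → Polynomial ℕ
  | ret φ => φ.cost
  | fix φ q => (.X * 8 + 4) + ((.X * ((.X * (φ.cost + 9) + 4) + (.X * 9 + 4) + (.X * 3 + 2) + 7) + 4)
      + q.cost)

end Query

namespace St

/-- Set the contents of `mem`. -/
def setMem (s : St Γ) (l : List Sym) : St Γ := { s with mem := l }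

theorem Good.setMem {s : St Γ} {n B : ℕ} {U : List (Fin 4)} (h : s.Good n B U) {l : List Sym}
    (hl : l.length ≤ B) : (s.setMem l).Good n B U :=
  ⟨⟨h.top, h.flag, h.num, h.tmp, h.tmp', h.val, h.le, hl⟩, h.left, h.val_eq, h.rem_eq⟩

theorem Good.setNew {s : St Γ} {n B : ℕ} {U : List (Fin 4)} (h : s.Good n B U) (l : List Sym) :
    ({ s with new := l } : St Γ).Good n B U :=
  ⟨⟨h.top, h.flag, h.num, h.tmp, h.tmp', h.val, h.le, h.length⟩, h.left, h.val_eq, h.rem_eq⟩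

theorem Good.setIter {s : St Γ} {n B : ℕ} {U : List (Fin 4)} (h : s.Good n B U) (a b : ℕ) :
    (s.setCtr .iter .iter' a b).Good n B U :=
  ⟨⟨h.top, h.flag, h.num, h.tmp, h.tmp', h.val, h.le, h.length⟩, h.left, h.val_eq, h.rem_eq⟩

theorem Good.env_eq {s : St Γ} {n B : ℕ} (h : s.Good n B []) : s.env = 0 :=
  funext fun i => h.val_eq i (by simp)

end St

open St

/-- The old relation must stay readable until all new bits are known, so these are collected on
`new`. Only then is the old relation dropped; pouring undoes the reversal of the order. -/
theorem ex_roundCmd {φ : Fml} (hφ : φ.wellScoped [0] = true) {s : St Γ} {n B : ℕ} {l X : List Sym}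
    (h : s.Good n B []) (hres : s.res = false) (hnew : s.new = []) (hmem : s.mem = X ++ l)
    (hX : X.length = n) :
    Ex (Query.roundCmd φ) s (s.setMem (φ.round n l X ++ l))
      ((B * (φ.cost.eval B + 9) + 4) + (B * 9 + 4) + (B * 3 + 2)) := by
  classical
  set f : ℕ → Sym := fun a => some (decide (φ.eval n (X ++ l) (update 0 0 a))) with hf
  have hn := h.le
  have h1 := Ex.forEach (c := .rem 0) (t := .val 0) (h := n) (T := φ.cost.eval B + 2)
    (P := .seq φ.cmd <| .seq (.prim (.push .new fun v => some v.res))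
      (.prim (.load fun v => { v with res := false }))) (by simp)
    (fun j => ({ s with new := ((List.range j).map f).reverse } : St Γ)) (fun _ _ => h.flag)
    fun j hj => by
      have hj' := (h.setNew ((List.range j).map f).reverse).bind 0 (a := n - 1 - j)
        (hj.le.trans h.le)
      have := ex_fml φ hφ hj' (decide (φ.eval n (X ++ l) (update 0 0 j))) (by
        rw [env_setCtr, decide_eq_true_iff]
        have : ({ s with new := ((List.range j).map f).reverse } : St Γ).env = 0 := h.env_eq
        rw [this]
        simp [setCtr, hmem])
      refine ((this.seq ((Ex.prim _ _).seq (Ex.prim _ _))).congr ?_).mono (by omega)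
      simp [setCtr, setRes, List.range_succ, hf, ← hres]
  have h2 := Ex.forEach_of_frame (c := .num) (t := .tmp) (h := n) (T := 2)
    (P := .seq (.prim (.pop .mem)) .reset) (by simp)
    (fun j => ({ s with new := ((List.range n).map f).reverse, mem := s.mem.drop j } : St Γ))
    (fun _ => h.flag) (fun _ => h.num) (fun _ => h.tmp) fun j hj a b => by
      refine ((Ex.prim _ _).seq (Ex.prim _ _)).congr ?_
      have h1 := h.top
      have h2 := h.flag
      simp [setCtr, ← h1, ← h2]
  have h3 := ex_pour (r := .new) (s := ({ s with
    new := ((List.range n).map f).reverse, mem := s.mem.drop n } : St Γ)) (by simp) h.top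
  rw [St.setCtr_self (s := ({ s with new := ((List.range 0).map f).reverse } : St Γ))
    (h.rem_eq 0 (by simp)) (h.val_eq 0 (by simp)),
    St.setCtr_self (s := ({ s with new := ((List.range n).map f).reverse } : St Γ))
    (h.rem_eq 0 (by simp)) (h.val_eq 0 (by simp))] at h1
  have e0 : ({ s with new := ((List.range 0).map f).reverse } : St Γ) = s :=
    St.ext rfl rfl rfl rfl rfl rfl rfl hnew.symm rfl
  rw [e0] at h1
  simp only [List.drop_zero] at h2
  refine ((h1.seq (h2.seq h3)).congr ?_).mono ?_
  · refine St.ext rfl rfl rfl rfl rfl ?_ rfl hnew.symm rfl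
    simp [setMem, hmem, hX, Fml.round, hf]
  · simp only [St.get, List.length_reverse, List.length_map, List.length_range]
    have : n * (φ.cost.eval B + 2 + 7) ≤ B * (φ.cost.eval B + 9) := by gcongr
    omega

theorem Fml.length_round (φ : Fml) (n : ℕ) (l X : List Sym) : (φ.round n l X).length = n := by
  simp [round]

theorem Fml.length_iterate_round (φ : Fml) (n : ℕ) (l : List Sym) (j : ℕ) :
    ((φ.round n l)^[j] (List.replicate n (some false))).length = n := by
  cases j with
  | zero => simp
  | succ j => rw [iterate_succ_apply', length_round]

/-- Every inductive definition leaves `n` more symbols in the memory, which accounts for `q.depth *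
n`. The final contents do not matter, only their length, for the cleanup. -/
theorem ex_query (q : Query) : ∀ {s : St Γ} {n B : ℕ}, q.wellScoped = true → s.Good n B [] →
    s.ctr .iter = n → s.ctr .iter' = 0 → s.res = false → s.new = [] →
    s.mem.length + q.depth * n ≤ B → ∀ b : Bool, (b = true ↔ q.eval n s.mem) →
    ∃ l : List Sym, l.length ≤ B ∧ Ex q.cmd s ((s.setMem l).setRes b) (q.cost.eval B) := by
  induction q with
  | ret φ =>
    intro s n B hq h _ _ _ _ _ b hb
    exact ⟨s.mem, h.length, ex_fml φ hq h b (by rw [h.env_eq]; exact hb)⟩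
  | fix φ q ih =>
    intro s n B hq h hit hit' hres hnew hB b hb
    simp only [Query.wellScoped, Bool.and_eq_true] at hq
    simp only [Query.depth, add_mul, one_mul] at hB
    set X : ℕ → List Sym := fun j => (φ.round n s.mem)^[j] (List.replicate n (some false)) with hX
    have hlen : ∀ j, (X j).length = n := φ.length_iterate_round n s.mem
    have hlen' : ∀ j, (X j ++ s.mem).length + q.depth * n ≤ B := fun j => by
      rw [List.length_append, hlen]; omega
    have hB' : ∀ j, (X j ++ s.mem).length ≤ B := fun j => by
      have := hlen' j
      omega
    have h1 := Ex.forEach_of_frame (c := .num) (t := .tmp) (h := n) (T := 1)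
      (P := .prim (.push .mem fun _ => some false)) (by simp)
      (fun j => s.setMem (List.replicate j (some false) ++ s.mem))
      (fun _ => h.flag) (fun _ => h.num) (fun _ => h.tmp) fun j hj a b => (Ex.prim _ _).congr rfl
    have h2 := Ex.forEach_of_frame (c := .iter) (t := .iter') (h := n) (P := Query.roundCmd φ)
      (by simp) (fun j => s.setMem (X j ++ s.mem)) (fun _ => h.flag) (fun _ => hit) (fun _ => hit')
      fun j hj a b => by
        have := ex_roundCmd hq.1 (l := s.mem) (X := X j) ((h.setMem (hB' j)).setIter a b)
          hres hnew rfl (hlen j)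
        refine this.congr ?_
        simp only [hX, iterate_succ_apply']
        rfl
    obtain ⟨l, hl, h3⟩ := ih hq.2 (h.setMem (hB' n)) hit hit' hres hnew (hlen' n) b hb
    refine ⟨l, hl, (h1.seq (h2.seq h3)).mono ?_⟩
    have hn := h.le
    simp only [Query.cost, Polynomial.eval_add, Polynomial.eval_mul, Polynomial.eval_X,
      Polynomial.eval_ofNat]
    gcongr
    norm_num

/-! ### Setup and cleanup -/

namespace Cmd

/-- Move the input to `mem`. -/
def load (f : Γ → Sym) : Cmd Γ :=
  .seq (.prim (.read f)) <| .seq (.loop (fun v => v.top.isSome) <|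
    .seq (.prim (.push .left fun v => v.top.getD none)) (.prim (.read f))) (.pour .left)

/-- Set the counters that have the length parameter as value. -/
def incAll : Cmd Γ :=
  .seq (.prim (.inc .num)) <| .seq (.prim (.inc .iter)) <| .seq (.prim (.inc (.rem 0))) <|
    .seq (.prim (.inc (.rem 1))) <| .seq (.prim (.inc (.rem 2))) (.prim (.inc (.rem 3)))

/-- Compute the length parameter. -/
def count : Cmd Γ :=
  .seq (.prim (.pop .mem)) <| .seq (.loop (fun v => v.top == some (some true)) <|
    .seq incAll <| .seq (.prim (.push .left fun v => v.top.getD none)) (.prim (.pop .mem))) <|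
  .seq (.ite (fun v => v.top.isSome) (.prim (.push .mem fun v => v.top.getD none)) .nop) <|
  .seq .reset (.pour .left)

def clearMem : Cmd Γ :=
  .seq (.prim (.pop .mem)) (.loop (fun v => v.top.isSome) (.prim (.pop .mem)))

def clearCtr (c : Ctr) : Cmd Γ :=
  .seq (.prim (.dec c)) (.loop Ctl.flag (.prim (.dec c)))

/-- Write the result and clear everything. -/
def finish : Cmd Γ :=
  .seq (.prim .write) <| .seq clearMem <| .seq (clearCtr .num) <| .seq (clearCtr .iter) <|
    .seq (clearCtr (.rem 0)) <| .seq (clearCtr (.rem 1)) <| .seq (clearCtr (.rem 2)) <|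
    .seq (clearCtr (.rem 3)) (.prim (.load fun _ => ⟨none, false, false⟩))

end Cmd

/-- The counters after the setup. -/
def setupCtr (n : ℕ) : Ctr → ℕ
  | .num | .iter | .rem _ => n
  | _ => 0

theorem ex_load (f : Γ → Sym) (l : List Γ) :
    Ex (.load f) (St.init l) ((St.init []).setMem (l.map f)) (l.length * 6 + 4) := by
  have key : ∀ (l : List Γ) (m : List Sym),
      Ex (.loop (fun v => v.top.isSome) <|
        .seq (.prim (.push .left fun v => v.top.getD none)) (.prim (.read f)))
        ⟨⟨l.head?.map f, false, false⟩, l.tail, [], [], m, [], 0⟩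
        ⟨⟨none, false, false⟩, [], [], [], (l.map f).reverse ++ m, [], 0⟩ (l.length * 3 + 1) := by
    intro l
    induction l with
    | nil => exact fun m => Ex.loop_false rfl
    | cons x l ih =>
      intro m
      refine ((Ex.loop_true rfl ((Ex.prim _ _).seq (Ex.prim _ _)) (ih (f x :: m))).congr ?_).mono ?_
      · simp
      · simp; omega
  refine (((Ex.prim _ _).seq ((key l []).seq (ex_pour (by simp) rfl))).congr ?_).mono ?_
  · simp [setMem, St.init]
  · simp; omega

/-- The length parameter of a word is the number of the bits `1` at its beginning. -/
def param (l : List Sym) : ℕ := (l.takeWhile (· == some true)).length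

theorem ex_inc (s : St Γ) (f : Ctr → ℕ) (c : Ctr) :
    Ex (.prim (.inc c)) { s with ctr := f } { s with ctr := update f c (f c + 1) } 1 :=
  Ex.prim _ _

theorem ex_incAll (s : St Γ) (n : ℕ) :
    Ex .incAll { s with ctr := setupCtr n } { s with ctr := setupCtr (n + 1) } 6 := by
  refine ((ex_inc _ _ _).seq ((ex_inc _ _ _).seq ((ex_inc _ _ _).seq ((ex_inc _ _ _).seq
    ((ex_inc _ _ _).seq (ex_inc _ _ _)))))).congr (congrArg (fun f => { s with ctr := f }) ?_)
  funext c
  rcases c with _ | _ | _ | _ | _ | i | i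
  case rem => fin_cases i <;> simp [setupCtr]
  all_goals simp [setupCtr]

theorem ex_count (l : List Sym) :
    Ex .count ((St.init ([] : List Γ)).setMem l)
      { (St.init ([] : List Γ)).setMem l with ctr := setupCtr (param l) } (l.length * 12 + 8) := by
  have key : ∀ (l m : List Sym) (n : ℕ),
      Ex (.seq (.loop (fun v => v.top == some (some true)) <|
        .seq .incAll <| .seq (.prim (.push .left fun v => v.top.getD none)) (.prim (.pop .mem))) <|
        .seq (.ite (fun v => v.top.isSome) (.prim (.push .mem fun v => v.top.getD none)) .nop) <|
        .seq .reset (.pour .left))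
        (⟨⟨l.head?, false, false⟩, [], [], l.tail, m, [], setupCtr n⟩ : St Γ)
        ⟨⟨none, false, false⟩, [], [], m.reverse ++ l, [], [], setupCtr (n + param l)⟩
        (l.length * 12 + m.length * 3 + 7) := by
    intro l
    induction l with
    | nil =>
      intro m n
      exact ((Ex.loop_false rfl).seq ((Ex.ite_false rfl (Ex.prim _ _)).seq ((Ex.prim _ _).seq
        (ex_pour (by simp) rfl)))).mono (by simp; omega)
    | cons x l ih =>
      intro m n
      by_cases hx : x = some true
      · subst hx
        -- Again the execution is split into loop and ending in order to prepend a round.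
        obtain ⟨t, ht, he⟩ := ih (some true :: m) (n + 1)
        cases he with
        | seq h1 h2 =>
          obtain ⟨u, hu, hi⟩ := ex_incAll
            (⟨⟨some (some true), false, false⟩, [], [], l, m, [], setupCtr n⟩ : St Γ) n
          have h3 := Exec.seq (Exec.loop_true (c := fun v => v.top == some (some true)) rfl
            (Exec.seq hi (Exec.seq (Exec.prim (.push .left fun v => v.top.getD none) _)
              (Exec.prim (.pop .mem) _))) h1) h2
          refine Ex.congr ⟨_, ?_, h3⟩ ?_
          · simp at ht ⊢; omega
          · simp [param, add_assoc, add_comm 1]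
      · refine (((Ex.loop_false (by simpa using hx)).seq ((Ex.ite_true rfl (Ex.prim _ _)).seq
          ((Ex.prim _ _).seq (ex_pour (by simp) rfl)))).congr ?_).mono (by simp; omega)
        simp [param, hx]
  have h0 : setupCtr 0 = 0 := funext fun c => by cases c <;> rfl
  have h1 := key l [] 0
  rw [zero_add, h0] at h1
  exact ((Ex.prim _ _).seq h1).mono (by simp; omega)

theorem ex_clearMem (s : St Γ) :
    Ex .clearMem s { s with top := none, mem := [] } (s.mem.length * 2 + 2) := by
  have key : ∀ (l : List Sym) (s : St Γ), s.top = l.head? → s.mem = l.tail →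
      Ex (.loop (fun v => v.top.isSome) (.prim (.pop .mem))) s
        { s with top := none, mem := [] } (l.length * 2 + 1) := by
    intro l
    induction l with
    | nil =>
      intro s h1 h2
      refine (Ex.loop_false (by simp [h1])).congr ?_
      simp at h1 h2
      simp [← h1, ← h2]
    | cons x l ih =>
      intro s h1 h2
      refine (Ex.loop_true (by simp [h1]) (Ex.prim _ _) (ih _ ?_ ?_)).mono ?_
      · simp at h2; simp [h2]
      · simp at h2; simp [h2]
      · simp; omega
  exact ((Ex.prim _ _).seq (key s.mem _ rfl rfl)).mono (by omega)

theorem ex_clearCtr (c : Ctr) (s : St Γ) :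
    Ex (.clearCtr c) s { s with flag := false, ctr := update s.ctr c 0 } (s.ctr c * 2 + 2) := by
  have key : ∀ (m : ℕ) (s : St Γ), s.flag = decide (0 < m) → s.ctr c = m - 1 →
      Ex (.loop Ctl.flag (.prim (.dec c))) s { s with flag := false, ctr := update s.ctr c 0 }
        (m * 2 + 1) := by
    intro m
    induction m with
    | zero =>
      intro s h1 h2
      refine (Ex.loop_false (by simp [h1])).congr ?_
      simp at h1 h2
      rw [← h2]
      simp [← h1]
    | succ m ih =>
      intro s h1 h2
      refine ((Ex.loop_true (by simp [h1]) (Ex.prim _ _) (ih _ ?_ ?_)).congr ?_).mono ?_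
      · simp at h2; simp [h2]
      · simp at h2; simp [h2]
      · simp
      · omega
  refine (((Ex.prim _ _).seq (key (s.ctr c) _ rfl (by simp))).congr ?_).mono (by omega)
  simp

theorem ex_finish (b : Bool) (l : List Sym) (n : ℕ) :
    Ex .finish (⟨⟨none, false, b⟩, [], [], l, [], [], setupCtr n⟩ : St Γ) (St.final b)
      (l.length * 2 + n * 12 + 16) := by
  have hc : ∀ c f, Ex (.clearCtr c) (⟨⟨none, false, b⟩, [], [b], [], [], [], f⟩ : St Γ)
      ⟨⟨none, false, b⟩, [], [b], [], [], [], update f c 0⟩ (f c * 2 + 2) :=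
    fun c f => ex_clearCtr c _
  have hm : Ex .clearMem (⟨⟨none, false, b⟩, [], [b], l, [], [], setupCtr n⟩ : St Γ)
      ⟨⟨none, false, b⟩, [], [b], [], [], [], setupCtr n⟩ (l.length * 2 + 2) := ex_clearMem _
  have hw : Ex (.prim .write) (⟨⟨none, false, b⟩, [], [], l, [], [], setupCtr n⟩ : St Γ)
      ⟨⟨none, false, b⟩, [], [b], l, [], [], setupCtr n⟩ 1 := Ex.prim _ _
  refine Ex.mono (Ex.congr (b' := St.final b) (hw.seq (hm.seq ((hc _ _).seq ((hc _ _).seq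
    ((hc _ _).seq ((hc _ _).seq ((hc _ _).seq ((hc _ _).seq (Ex.prim _ _)))))))))
    (St.ext rfl rfl rfl rfl rfl rfl rfl rfl ?_)) ?_
  · funext c
    rcases c with _ | _ | _ | _ | _ | i | i
    case rem => fin_cases i <;> simp [St.final]
    all_goals simp [setupCtr, St.final]
  · simp [setupCtr]; omega

/-- The question that a query asks about a word. -/
def Query.holds (q : Query) (l : List Sym) : Prop := q.eval (param l) l

/-- The complexity-theoretic core: load the input, count the leading ones, evaluate, clean up. All
costs are polynomial in the size bound `B` of the memory. -/
theorem Query.polyTimeDecidable (q : Query) (hq : q.wellScoped = true) {α : Type} [Fintype Γ]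
    (enc : α → List Γ) (f : Γ → Sym) :
    Complexity.PolyTimeDecidable enc fun a => q.holds ((enc a).map f) := by
  classical
  refine polyTimeDecidable_of_exec enc _
    (.seq (.load f) <| .seq .count <| .seq q.cmd .finish)
    (.X * 18 + 12 + q.cost.comp ((q.depth + 1 : ℕ) * .X) +
      ((q.depth + 1 : ℕ) * .X) * 14 + 16) fun a => ?_
  set l := (enc a).map f with hl
  have hlen : l.length = (enc a).length := by simp [hl]
  refine ⟨decide (q.holds l), decide_eq_true_iff, ?_⟩
  have hn : param l ≤ l.length := (List.takeWhile_sublist _).length_le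
  -- The word itself and, for each inductive definition, a relation of length `param l ≤ l.length`.
  set B := (q.depth + 1) * l.length with hBdef
  have hlB : l.length ≤ B := Nat.le_mul_of_pos_left _ (by omega)
  have hB : l.length + q.depth * param l ≤ B := by
    rw [hBdef, add_mul, one_mul, add_comm]
    gcongr
  obtain ⟨l', hl', h3⟩ := ex_query q (Γ := Γ)
    (s := { (St.init ([] : List Γ)).setMem l with ctr := setupCtr (param l) })
    (n := param l) (B := B) hq
    ⟨⟨rfl, rfl, rfl, rfl, rfl, fun _ => Nat.zero_le _, hn.trans hlB, hlB⟩, rfl, fun _ _ => rfl,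
      fun _ _ => rfl⟩ rfl rfl rfl rfl hB (decide (q.holds l)) decide_eq_true_iff
  refine ((ex_load f (enc a)).seq ((ex_count l).seq (h3.seq (ex_finish _ l' (param l))))).mono ?_
  have : param l ≤ B := hn.trans hlB
  simp only [Polynomial.eval_add, Polynomial.eval_mul, Polynomial.eval_X, Polynomial.eval_ofNat,
    Polynomial.eval_comp, Polynomial.eval_natCast, Nat.cast_id, ← hlen, ← hBdef]
  omega

end StackMachine
end

noncomputable section

/-! ### Semantics of argumentation frameworks, elementwise -/

namespace Argumentation

variable {α : Type}

namespace AF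

variable {F : AF α} {S : Set α}

theorem mem_attackedBy {a : α} : a ∈ F.attackedBy S ↔ ∃ b ∈ S, (b, a) ∈ F.R :=
  ⟨fun h => h.2, fun h => ⟨let ⟨_, _, hb⟩ := h; (F.R_sub hb).2, h⟩⟩

theorem conflictFree_iff : F.ConflictFree S ↔ ∀ a ∈ S, ∀ b ∈ S, (a, b) ∉ F.R := by
  simp only [ConflictFree, Set.eq_empty_iff_forall_notMem, Set.mem_inter_iff, mem_attackedBy]
  exact ⟨fun h a ha b hb hab => h b ⟨hb, a, ha, hab⟩, fun h b ⟨hb, a, ha, hab⟩ => h a ha b hb hab⟩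

theorem mem_ad : S ∈ F.ad ↔ S ⊆ F.A ∧ (∀ a ∈ S, ∀ b ∈ S, (a, b) ∉ F.R) ∧
    ∀ a ∈ S, ∀ b, (b, a) ∈ F.R → ∃ c ∈ S, (c, b) ∈ F.R := by
  simp only [ad, Set.mem_ofPred_eq, conflictFree_iff]
  refine and_congr_right fun hS => and_congr_right fun _ => ⟨fun h a ha b hb => ?_,
    fun h a ha => ⟨hS ha, fun b hb => mem_attackedBy.2 (h a ha b hb)⟩⟩
  exact mem_attackedBy.1 ((h ha).2 b hb)

theorem mem_st : S ∈ F.st ↔ S ⊆ F.A ∧ (∀ a ∈ S, ∀ b ∈ S, (a, b) ∉ F.R) ∧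
    ∀ a ∈ F.A, a ∉ S → ∃ c ∈ S, (c, a) ∈ F.R := by
  simp only [st, Set.mem_ofPred_eq, conflictFree_iff]
  refine and_congr_right fun hS => and_congr_right fun hcf => ⟨fun h a ha haS => ?_, fun h => ?_⟩
  · exact mem_attackedBy.1 (h ▸ ⟨ha, haS⟩ : a ∈ F.attackedBy S)
  · ext a
    rw [mem_attackedBy]
    refine ⟨fun ⟨b, hb, hba⟩ => ⟨(F.R_sub hba).2, fun ha => hcf b hb a ha hba⟩, fun ha => ?_⟩
    exact h a ha.1 ha.2

theorem mem_co : S ∈ F.co ↔ S ∈ F.ad ∧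
    ∀ a ∈ F.A, (∀ b, (b, a) ∈ F.R → ∃ c ∈ S, (c, b) ∈ F.R) → a ∈ S := by
  simp only [co, Set.mem_ofPred_eq]
  refine and_congr_right fun _ => ⟨fun h a ha hd => h a ⟨ha, fun b hb => ?_⟩,
    fun h a ha => h a ha.1 fun b hb => mem_attackedBy.1 (ha.2 b hb)⟩
  exact mem_attackedBy.2 (hd b hb)

/-- The least fixed point of the characteristic function. -/
def leastFixed (F : AF α) : Set α :=
  {a | ∀ X : Set α, (∀ b ∈ F.A, (∀ c, (c, b) ∈ F.R → ∃ d ∈ X, (d, c) ∈ F.R) → b ∈ X) → a ∈ X}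

theorem mem_leastFixed_of_defended {a : α} (ha : a ∈ F.A)
    (h : ∀ c, (c, a) ∈ F.R → ∃ d ∈ F.leastFixed, (d, c) ∈ F.R) : a ∈ F.leastFixed :=
  fun X hX => hX a ha fun c hc => let ⟨d, hd, hdc⟩ := h c hc; ⟨d, hd X hX, hdc⟩

/-- Induction over the least fixed point: the asserted property itself is taken as the closed set
`X`. -/
theorem leastFixed_defended {a : α} (ha : a ∈ F.leastFixed) :
    a ∈ F.A ∧ ∀ c, (c, a) ∈ F.R → ∃ d ∈ F.leastFixed, (d, c) ∈ F.R := by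
  refine ha {a | a ∈ F.A ∧ ∀ c, (c, a) ∈ F.R → ∃ d ∈ F.leastFixed, (d, c) ∈ F.R}
    fun b hb h => ⟨hb, fun c hc => ?_⟩
  obtain ⟨d, hd, hdc⟩ := h c hc
  exact ⟨d, mem_leastFixed_of_defended hd.1 hd.2, hdc⟩

/-- Induction again. If a member `c` attacked `b`, some `d` with the property would attack `c`; but
`c` is defended, so a member would attack `d`, which the property excludes. -/
theorem leastFixed_conflictFree {a : α} (ha : a ∈ F.leastFixed) :
    a ∈ F.leastFixed ∧ ∀ b ∈ F.leastFixed, (b, a) ∉ F.R := by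
  refine ha {a | a ∈ F.leastFixed ∧ ∀ b ∈ F.leastFixed, (b, a) ∉ F.R}
    fun b hb h => ⟨?_, fun c hc hcb => ?_⟩
  · exact mem_leastFixed_of_defended hb fun c hc => let ⟨d, hd, hdc⟩ := h c hc; ⟨d, hd.1, hdc⟩
  · obtain ⟨d, hd, hdc⟩ := h c hcb
    obtain ⟨e, he, hed⟩ := (leastFixed_defended hc).2 d hdc
    exact hd.2 e he hed

theorem leastFixed_mem_co : F.leastFixed ∈ F.co :=
  mem_co.2 ⟨mem_ad.2 ⟨fun _ ha => (leastFixed_defended ha).1,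
    fun a ha _ hb => (leastFixed_conflictFree hb).2 a ha,
    fun _ ha => (leastFixed_defended ha).2⟩, fun _ ha => mem_leastFixed_of_defended ha⟩

/-- A complete set is closed under defence and so contains `leastFixed`, which is itself complete;
hence minimality means equality with it. Closure of `X` is only required for elements of `S`, and
replacing `X` by `X ∩ S` makes this full closure. In this form no completeness of other sets occurs,
and the test becomes an inductive definition inside `S`. -/
theorem mem_gr : S ∈ F.gr ↔ S ∈ F.co ∧
    ∀ X : Set α, (∀ a ∈ S, (∀ b, (b, a) ∈ F.R → ∃ c ∈ X, (c, b) ∈ F.R) → a ∈ X) → S ⊆ X := by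
  refine ⟨fun h => ⟨h.prop, fun X hX a ha => ?_⟩, fun ⟨hS, h⟩ => ⟨hS, fun T hT hTS => ?_⟩⟩
  · have hS := mem_co.1 h.prop
    have hle : F.leastFixed ≤ S := fun a ha => ha S hS.2
    refine (h.le_of_le leastFixed_mem_co hle ha (X ∩ S) fun b hb hd => ?_).1
    have hbS := hS.2 b hb fun c hc => let ⟨d, hd, hdc⟩ := hd c hc; ⟨d, hd.2, hdc⟩
    exact ⟨hX b hbS fun c hc => let ⟨d, hd, hdc⟩ := hd c hc; ⟨d, hd.1, hdc⟩, hbS⟩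
  · have hT' := mem_co.1 hT
    exact h T fun a ha hd => hT'.2 a ((mem_ad.1 (mem_co.1 hS).1).1 ha) hd

theorem mem_pr : S ∈ F.pr ↔ S ∈ F.ad ∧ ∀ T, T ∈ F.ad → S ⊆ T → T ⊆ S :=
  ⟨fun h => ⟨h.prop, fun _ hT hST => h.le_of_ge hT hST⟩, fun h => ⟨h.1, fun T hT => h.2 T hT⟩⟩

end AF

/-! ### Completions -/

namespace IAF

variable (I : IAF α)

/-- The completion with the uncertain arguments in `B` and the uncertain attacks in `T`. -/
def choose (B : Set α) (T : Set (α × α)) : AF α where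
  A := I.A ∪ B ∩ I.Aq
  R := (I.R ∪ T ∩ I.Rq) ∩ (I.A ∪ B ∩ I.Aq) ×ˢ (I.A ∪ B ∩ I.Aq)
  R_sub := Set.inter_subset_right

/-- The IAF without uncertain elements that has the same completion as `choose`. -/
def chooseIAF (B : Set α) (T : Set (α × α)) : IAF α where
  A := (I.choose B T).A
  Aq := ∅
  R := (I.choose B T).R
  Rq := ∅
  disj_A := Set.disjoint_empty _
  disj_R := Set.disjoint_empty _
  R_sub := (I.choose B T).R_sub.trans (by simp)
  Rq_sub := Set.empty_subset _

variable {I}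

theorem chooseIAF_isPart (B : Set α) (T : Set (α × α)) : I.chooseIAF B T ∈ I.part := by
  refine ⟨⟨Set.subset_union_left, ?_⟩, ⟨?_, ?_⟩, Set.empty_subset _, Set.empty_subset _⟩
  · exact Set.union_subset_union_right _ Set.inter_subset_right
  · rintro r ⟨hr, hr'⟩
    simp only [chooseIAF, Set.union_empty] at hr'
    exact ⟨Or.inl hr, hr'⟩
  · exact Set.inter_subset_left.trans (Set.union_subset_union_right _ Set.inter_subset_right)

/-- The chosen elements can be read off from `J`, because a partial completion must keep every
certain attack between arguments that it has. -/
theorem cert_eq_choose {J : IAF α} (hJ : J ∈ I.part) : J.cert = I.choose J.A J.R := by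
  obtain ⟨⟨h1, h2⟩, ⟨h3, h4⟩, -, -⟩ := hJ
  have hA : J.A = I.A ∪ J.A ∩ I.Aq := by
    ext a
    have := @h1 a
    have := @h2 a
    simp only [Set.mem_union, Set.mem_inter_iff] at *
    tauto
  have hR : J.R ∩ J.A ×ˢ J.A = (I.R ∪ J.R ∩ I.Rq) ∩ J.A ×ˢ J.A := by
    ext ⟨a, b⟩
    have := @h3 (a, b)
    have := @h4 (a, b)
    simp only [Set.mem_union, Set.mem_inter_iff, Set.mem_prod] at *
    tauto
  simp only [cert, choose, ← hA, hR]

theorem self_mem_part (J : IAF α) : J ∈ J.part :=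
  ⟨⟨subset_rfl, Set.subset_union_left⟩, ⟨Set.inter_subset_left, Set.subset_union_left⟩,
    subset_rfl, subset_rfl⟩

/-- Stability can be reached iff some completion has the status. -/
theorem canReach_iff {S : Set α} {j : Semantics × Bool} :
    I.CanReach S j ↔ ∃ B T, HasStatus (I.choose B T) S j := by
  constructor
  · rintro ⟨J, hJ, hst⟩
    exact ⟨J.A, J.R, cert_eq_choose hJ ▸ hst _ ⟨J, J.self_mem_part, rfl⟩⟩
  · rintro ⟨B, T, h⟩
    refine ⟨_, chooseIAF_isPart B T, ?_⟩
    -- Nothing is uncertain in `chooseIAF B T`, so a partial completion `J` of it has the same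
    -- arguments and attacks.
    rintro F ⟨J, ⟨⟨h1, h2⟩, ⟨h3, h4⟩, h5, h6⟩, rfl⟩
    simp only [chooseIAF, Set.union_empty, Set.subset_empty_iff] at h1 h2 h3 h4 h5 h6
    have hA : J.A = (I.choose B T).A := h2.antisymm h1
    rw [h5, Set.union_empty, hA, Set.inter_eq_left.2 (I.choose B T).R_sub] at h3
    have hR : J.R = (I.choose B T).R := h4.antisymm h3
    have : J.cert = I.choose B T := by
      simp only [cert, hA, hR, Set.inter_eq_left.2 (I.choose B T).R_sub]
    rwa [this]

/-- The possible arguments. -/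
def PA (I : IAF α) : Set α := I.A ∪ I.Aq

/-- The possible attacks. -/
def PR (I : IAF α) : Set (α × α) := I.R ∪ I.Rq

section choose

variable {B : Set α} {T : Set (α × α)} {S : Set α} {a b : α}

theorem mem_PA : a ∈ I.PA ↔ a ∈ I.A ∨ a ∈ I.Aq := Iff.rfl

theorem mem_PR {r : α × α} : r ∈ I.PR ↔ r ∈ I.R ∨ r ∈ I.Rq := Iff.rfl

theorem mem_choose_A : a ∈ (I.choose B T).A ↔ a ∈ I.A ∨ a ∈ B ∧ a ∈ I.Aq := Iff.rfl

theorem mem_choose_R : (a, b) ∈ (I.choose B T).R ↔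
    ((a, b) ∈ I.R ∨ (a, b) ∈ T ∧ (a, b) ∈ I.Rq) ∧
      a ∈ (I.choose B T).A ∧ b ∈ (I.choose B T).A := Iff.rfl

theorem PR_of_choose (h : (a, b) ∈ (I.choose B T).R) : (a, b) ∈ I.PR := h.1.imp_right And.right

theorem PA_of_choose (h : a ∈ (I.choose B T).A) : a ∈ I.PA := h.imp_right And.right

theorem choose_of_R (h : (a, b) ∈ I.R) (ha : a ∈ (I.choose B T).A) (hb : b ∈ (I.choose B T).A) :
    (a, b) ∈ (I.choose B T).R := ⟨Or.inl h, ha, hb⟩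

theorem choose_of_PR (h : (a, b) ∈ I.PR) (hT : (a, b) ∈ T) (ha : a ∈ (I.choose B T).A)
    (hb : b ∈ (I.choose B T).A) : (a, b) ∈ (I.choose B T).R :=
  ⟨h.imp_right fun h => ⟨hT, h⟩, ha, hb⟩

end choose

/-! ### Possible extensions -/

/-- The certain attacks do not contradict the conflict-freeness of `S`. -/
def Compatible (I : IAF α) (S : Set α) : Prop := S ⊆ I.PA ∧ ∀ a ∈ S, ∀ b ∈ S, (a, b) ∉ I.R

/-- The arguments in `U` can be made neither defended nor attacked by `S`. -/
def Undecided (I : IAF α) (S U : Set α) : Prop :=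
  ∀ u ∈ U, u ∈ I.PA ∧ u ∉ S ∧ (∀ s ∈ S, (s, u) ∉ I.R ∧ (u, s) ∉ I.R) ∧ ∃ b ∈ U, (b, u) ∈ I.PR

/-- The only condition that refers to `U` asks for an attacker inside `U`, and it survives enlarging
`U`. So there is a largest undecided set. -/
theorem Undecided.sUnion {S : Set α} {𝒰 : Set (Set α)} (h : ∀ U ∈ 𝒰, I.Undecided S U) :
    I.Undecided S (⋃₀ 𝒰) := by
  rintro u ⟨U, hU, hu⟩
  obtain ⟨h1, h2, h3, b, hb, hbu⟩ := h U hU u hu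
  exact ⟨h1, h2, h3, b, ⟨U, hU, hb⟩, hbu⟩

/-- The completion in which `S` attacks all but `U`, and no argument outside attacks `S` unless it
has to. -/
def favour (I : IAF α) (S U : Set α) : AF α :=
  I.choose (S ∪ U) {r | r.2 ∉ S ∧ (r.1 ∈ S → r.2 ∉ U)}

/-! ### The most favourable completion -/

section favour

variable {S U : Set α}

theorem favour_subset (hS : I.Compatible S) : S ⊆ (I.favour S U).A := fun _ ha =>
  (hS.1 ha).imp_right fun h => ⟨Or.inl ha, h⟩

theorem favour_conflictFree (hS : I.Compatible S) : ∀ a ∈ S, ∀ b ∈ S, (a, b) ∉ (I.favour S U).R := by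
  rintro a ha b hb ⟨h | h, -⟩
  · exact hS.2 a ha b hb h
  · exact h.1.1 hb

/-- Uncertain attacks on `S` are absent, so the attack is certain; this rules out `S` and `U` as its
origin, and no other uncertain arguments are present. -/
theorem favour_attacker (hS : I.Compatible S) (hU : I.Undecided S U) {a b : α} (ha : a ∈ S)
    (h : (b, a) ∈ (I.favour S U).R) : b ∈ I.A ∧ (b, a) ∈ I.R ∧ b ∉ S ∧ b ∉ U := by
  have hba : (b, a) ∈ I.R := h.1.resolve_right fun h => h.1.1 ha
  have hbS : b ∉ S := fun hb => hS.2 b hb a ha hba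
  have hbU : b ∉ U := fun hb => ((hU b hb).2.2.1 a ha).2 hba
  exact ⟨h.2.1.resolve_right fun h => h.1.elim hbS hbU, hba, hbS, hbU⟩

theorem favour_attack (hS : I.Compatible S) {a b : α} (ha : a ∈ S) (hb : b ∈ (I.favour S U).A)
    (hbS : b ∉ S) (hbU : b ∉ U) (h : (a, b) ∈ I.PR) : (a, b) ∈ (I.favour S U).R :=
  choose_of_PR h ⟨hbS, fun _ => hbU⟩ (favour_subset hS ha) hb

theorem favour_not_attack (hU : I.Undecided S U) {a b : α} (ha : a ∈ S) (hb : b ∈ U) :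
    (a, b) ∉ (I.favour S U).R := by
  rintro ⟨h | h, -⟩
  · exact ((hU b hb).2.2.1 a ha).1 h
  · exact h.1.2 ha hb

theorem favour_mem_ad (hS : I.Compatible S) (hU : I.Undecided S U)
    (h : ∀ a ∈ S, ∀ b ∈ I.A, (b, a) ∈ I.R → ∃ c ∈ S, (c, b) ∈ I.PR) : S ∈ (I.favour S U).ad := by
  refine AF.mem_ad.2 ⟨favour_subset hS, favour_conflictFree hS, fun a ha b hb => ?_⟩
  obtain ⟨h1, h2, h3, h4⟩ := favour_attacker hS hU ha hb
  obtain ⟨c, hc, hcb⟩ := h a ha b h1 h2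
  exact ⟨c, hc, favour_attack hS hc hb.2.1 h3 h4 hcb⟩

end favour

theorem undecided_empty (S : Set α) : I.Undecided S ∅ := fun _ h => h.elim

theorem compatible_of_choose {B : Set α} {T : Set (α × α)} {S : Set α}
    (h1 : S ⊆ (I.choose B T).A) (h2 : ∀ a ∈ S, ∀ b ∈ S, (a, b) ∉ (I.choose B T).R) :
    I.Compatible S :=
  ⟨fun _ ha => PA_of_choose (h1 ha), fun a ha b hb hab =>
    h2 a ha b hb (choose_of_R hab (h1 ha) (h1 hb))⟩

variable {S : Set α}

/-- Certain attacks from certain arguments cannot be avoided and only possible attacks can answer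
them; `favour` with `U = ∅` shows that nothing else is needed. -/
theorem exists_ad_iff : (∃ B T, S ∈ (I.choose B T).ad) ↔ I.Compatible S ∧
    ∀ a ∈ S, ∀ b ∈ I.A, (b, a) ∈ I.R → ∃ c ∈ S, (c, b) ∈ I.PR := by
  refine ⟨fun ⟨B, T, h⟩ => ?_, fun h => ⟨_, _, favour_mem_ad h.1 (undecided_empty S) h.2⟩⟩
  obtain ⟨h1, h2, h3⟩ := AF.mem_ad.1 h
  refine ⟨compatible_of_choose h1 h2, fun a ha b hb hba => ?_⟩
  obtain ⟨c, hc, hcb⟩ := h3 a ha b (choose_of_R hba (Or.inl hb) (h1 ha))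
  exact ⟨c, hc, PR_of_choose hcb⟩

theorem exists_st_iff : (∃ B T, S ∈ (I.choose B T).st) ↔ I.Compatible S ∧
    ∀ a ∈ I.A, a ∉ S → ∃ c ∈ S, (c, a) ∈ I.PR := by
  refine ⟨fun ⟨B, T, h⟩ => ?_, fun ⟨hS, h⟩ => ⟨S ∪ ∅, _, AF.mem_st.2 ⟨favour_subset (U := ∅) hS,
    favour_conflictFree hS, fun a ha haS => ?_⟩⟩⟩
  · obtain ⟨h1, h2, h3⟩ := AF.mem_st.1 h
    refine ⟨compatible_of_choose h1 h2, fun a ha haS => ?_⟩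
    obtain ⟨c, hc, hca⟩ := h3 a (Or.inl ha) haS
    exact ⟨c, hc, PR_of_choose hca⟩
  · obtain ⟨c, hc, hca⟩ := h a (ha.resolve_right fun h => by simp [haS] at h) haS
    exact ⟨c, hc, favour_attack hS hc ha haS (by simp) hca⟩

/-- The condition for the existence of a completion for which `S` is complete. -/
def CoCond (I : IAF α) (S : Set α) : Prop :=
  (∀ a ∈ S, ∀ b ∈ I.A, (b, a) ∈ I.R → ∃ c ∈ S, (c, b) ∈ I.PR) ∧
    ∀ a ∈ I.A, a ∉ S → (∃ U, I.Undecided S U ∧ a ∈ U) ∨ ∃ c ∈ S, (c, a) ∈ I.PR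

theorem coCond_of_mem_co {B : Set α} {T : Set (α × α)} (h : S ∈ (I.choose B T).co) :
    I.Compatible S ∧ I.CoCond S := by
  obtain ⟨had, hco⟩ := AF.mem_co.1 h
  obtain ⟨h1, h2, h3⟩ := AF.mem_ad.1 had
  have had' := exists_ad_iff.1 ⟨B, T, had⟩
  refine ⟨had'.1, had'.2, fun a ha haS => ?_⟩
  by_cases hS : ∃ c ∈ S, (c, a) ∈ (I.choose B T).R
  · exact Or.inr (hS.imp fun c hc => ⟨hc.1, PR_of_choose hc.2⟩)
  -- The arguments that are neither in `S` nor attacked by it. By completeness each of them is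
  -- undefended, and the attacker responsible is of the same kind.
  refine Or.inl ⟨{u | u ∈ (I.choose B T).A ∧ u ∉ S ∧ ¬ ∃ c ∈ S, (c, u) ∈ (I.choose B T).R},
    fun u ⟨hu1, hu2, hu3⟩ => ⟨PA_of_choose hu1, hu2, fun s hs => ⟨fun h => ?_, fun h => ?_⟩, ?_⟩,
    Or.inl ha, haS, hS⟩
  · exact hu3 ⟨s, hs, choose_of_R h (h1 hs) hu1⟩
  · exact hu3 (h3 s hs u (choose_of_R h hu1 (h1 hs)))
  · by_contra hcon
    refine hu2 (hco u hu1 fun b hb => ?_)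
    by_contra hb'
    refine hcon ⟨b, ⟨hb.2.1, fun hbS => hu3 ⟨b, hbS, hb⟩, hb'⟩, PR_of_choose hb⟩

/-- Take the largest undecided `U`. An element of `U` has an attacker in `U`, which `S` does not
attack, so it is not defended. Any other argument outside `S` is certain and attacked by `S`;
defending it would force `S` to attack itself. -/
theorem favour_mem_co (hS : I.Compatible S) (h : I.CoCond S) :
    ∃ U, I.Undecided S U ∧ S ∈ (I.favour S U).co := by
  have hU := Undecided.sUnion (I := I) (S := S) (𝒰 := {U | I.Undecided S U}) fun _ h => h
  set U := ⋃₀ {U | I.Undecided S U} with hUdef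
  refine ⟨U, hU, AF.mem_co.2 ⟨favour_mem_ad hS hU h.1, fun a ha hd => ?_⟩⟩
  by_contra haS
  by_cases haU : a ∈ U
  · obtain ⟨h1, h2, h3, b, hb, hba⟩ := hU a haU
    have hbS := (hU b hb).2.1
    have hbA : b ∈ (I.favour S U).A := (hU b hb).1.imp_right fun h => ⟨Or.inr hb, h⟩
    obtain ⟨c, hc, hcb⟩ := hd b (choose_of_PR hba ⟨h2, fun h => (hbS h).elim⟩ hbA ha)
    exact favour_not_attack hU hc hb hcb
  · have haA : a ∈ I.A := ha.resolve_right fun h => h.1.elim haS haU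
    obtain ⟨U', hU', haU'⟩ | ⟨c, hc, hca⟩ := h.2 a haA haS
    · exact haU ⟨U', hU', haU'⟩
    · obtain ⟨d, hd, hdc⟩ := hd c (favour_attack hS hc ha haS haU hca)
      exact favour_conflictFree hS d hd c hc hdc

theorem exists_co_iff : (∃ B T, S ∈ (I.choose B T).co) ↔ I.Compatible S ∧ I.CoCond S :=
  ⟨fun ⟨_, _, h⟩ => coCond_of_mem_co h, fun ⟨hS, h⟩ =>
    let ⟨_, _, h⟩ := favour_mem_co hS h
    ⟨_, _, h⟩⟩

/-- The completion used for completeness also makes defence within `S` easiest: only certain attacks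
on `S` remain, and every possible attack from `S` on such attackers is present. -/
theorem exists_gr_iff : (∃ B T, S ∈ (I.choose B T).gr) ↔ (I.Compatible S ∧ I.CoCond S) ∧
    ∀ X : Set α, (∀ a ∈ S, (∀ b ∈ I.A, (b, a) ∈ I.R → ∃ c ∈ X, (c, b) ∈ I.PR) → a ∈ X) →
      S ⊆ X := by
  refine ⟨fun ⟨B, T, h⟩ => ?_, fun ⟨⟨hS, hco⟩, h⟩ => ?_⟩
  · obtain ⟨h1, h2⟩ := AF.mem_gr.1 h
    have hSA := (AF.mem_ad.1 (AF.mem_co.1 h1).1).1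
    refine ⟨coCond_of_mem_co h1, fun X hX => h2 X fun a ha hd => hX a ha fun b hb hba => ?_⟩
    obtain ⟨c, hc, hcb⟩ := hd b (choose_of_R hba (Or.inl hb) (hSA ha))
    exact ⟨c, hc, PR_of_choose hcb⟩
  · obtain ⟨U, hU, hF⟩ := favour_mem_co hS hco
    refine ⟨_, _, AF.mem_gr.2 ⟨hF, fun X hX => ?_⟩⟩
    refine (h (X ∩ S) fun a ha hd => ⟨hX a ha fun b hb => ?_, ha⟩).trans Set.inter_subset_left
    obtain ⟨h1, h2, h3, h4⟩ := favour_attacker hS hU ha hb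
    obtain ⟨c, hc, hcb⟩ := hd b h1 h2
    exact ⟨c, hc.1, favour_attack hS hc.2 hb.2.1 h3 h4 hcb⟩

/-! ### Possible non-extensions -/

/-- The set `S` is admissible in all completions. -/
def AlwaysAd (I : IAF α) (S : Set α) : Prop :=
  S ⊆ I.A ∧ (∀ a ∈ S, ∀ b ∈ S, (a, b) ∉ I.PR) ∧
    ∀ a ∈ S, ∀ b ∈ I.PA, (b, a) ∈ I.PR → ∃ c ∈ S, (c, b) ∈ I.R

theorem AlwaysAd.mem_ad (h : I.AlwaysAd S) (B : Set α) (T : Set (α × α)) :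
    S ∈ (I.choose B T).ad := by
  obtain ⟨h1, h2, h3⟩ := h
  refine AF.mem_ad.2 ⟨fun a ha => Or.inl (h1 ha), fun a ha b hb hab => h2 a ha b hb
    (PR_of_choose hab), fun a ha b hb => ?_⟩
  obtain ⟨c, hc, hcb⟩ := h3 a ha b (PA_of_choose (T := T) hb.2.1) (PR_of_choose hb)
  exact ⟨c, hc, choose_of_R hcb (Or.inl (h1 hc)) hb.2.1⟩

theorem subset_of_forall (h : ∀ B T, S ⊆ (I.choose B T).A) : S ⊆ I.A := fun _ ha =>
  (h ∅ ∅ ha).resolve_right fun h => h.1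

theorem not_PR_of_forall (hSA : S ⊆ I.A)
    (h : ∀ B T, ∀ a ∈ S, ∀ b ∈ S, (a, b) ∉ (I.choose B T).R) :
    ∀ a ∈ S, ∀ b ∈ S, (a, b) ∉ I.PR := fun a ha b hb hab =>
  h ∅ Set.univ a ha b hb (choose_of_PR hab trivial (Or.inl (hSA ha)) (Or.inl (hSA hb)))

theorem forall_ad_iff : (∀ B T, S ∈ (I.choose B T).ad) ↔ I.AlwaysAd S := by
  refine ⟨fun h => ?_, fun h B T => h.mem_ad B T⟩
  have hSA : S ⊆ I.A := subset_of_forall fun B T => (AF.mem_ad.1 (h B T)).1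
  have hcf := not_PR_of_forall hSA fun B T => (AF.mem_ad.1 (h B T)).2.1
  refine ⟨hSA, hcf, fun a ha b hb hba => ?_⟩
  have hbA : ∀ T, b ∈ (I.choose Set.univ T).A := fun T => hb.imp_right fun h => ⟨trivial, h⟩
  -- With `(b, a)` as the only uncertain attack, the counterattack is certain, unless it is `(b, a)`
  -- itself; then `a` would attack itself.
  obtain ⟨c, hc, hcb⟩ := (AF.mem_ad.1 (h Set.univ {(b, a)})).2.2 a ha b
    (choose_of_PR hba rfl (hbA _) (Or.inl (hSA ha)))
  refine ⟨c, hc, hcb.1.resolve_right fun h => ?_⟩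
  obtain ⟨rfl, rfl⟩ := Prod.mk.inj h.1
  exact hcf _ ha _ ha hba

theorem forall_st_iff : (∀ B T, S ∈ (I.choose B T).st) ↔
    S ⊆ I.A ∧ (∀ a ∈ S, ∀ b ∈ S, (a, b) ∉ I.PR) ∧
      ∀ a ∈ I.PA, a ∉ S → ∃ c ∈ S, (c, a) ∈ I.R := by
  refine ⟨fun h => ?_, fun ⟨h1, h2, h3⟩ B T => AF.mem_st.2 ⟨fun a ha => Or.inl (h1 ha),
    fun a ha b hb hab => h2 a ha b hb (PR_of_choose hab), fun a ha haS => ?_⟩⟩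
  · have hSA : S ⊆ I.A := subset_of_forall fun B T => (AF.mem_st.1 (h B T)).1
    refine ⟨hSA, not_PR_of_forall hSA fun B T => (AF.mem_st.1 (h B T)).2.1, fun a ha haS => ?_⟩
    obtain ⟨c, hc, hca⟩ := (AF.mem_st.1 (h Set.univ ∅)).2.2 a
      (ha.imp_right fun h => ⟨trivial, h⟩) haS
    exact ⟨c, hc, hca.1.resolve_right fun h => h.1⟩
  · obtain ⟨c, hc, hca⟩ := h3 a (PA_of_choose ha) haS
    exact ⟨c, hc, choose_of_R hca (Or.inl (h1 hc)) ha⟩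

/-- The set `S` is complete in all completions. -/
def AlwaysCo (I : IAF α) (S : Set α) : Prop :=
  I.AlwaysAd S ∧ ∀ a ∈ I.PA, a ∉ S → (a, a) ∉ I.R →
    ∃ b ∈ I.A, (b, a) ∈ I.R ∧ ∀ c ∈ S, (c, b) ∉ I.PR

theorem forall_co_iff : (∀ B T, S ∈ (I.choose B T).co) ↔ I.AlwaysCo S := by
  constructor
  · intro h
    have had := forall_ad_iff.1 fun B T => (AF.mem_co.1 (h B T)).1
    refine ⟨had, fun a ha haS haa => ?_⟩
    by_contra hcon
    -- The completion most inclined to defend `a`: no uncertain argument but `a`, and all uncertain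
    -- attacks except those on `a`.
    refine haS ((AF.mem_co.1 (h {a} {r | r.2 ≠ a})).2 a (ha.imp_right fun h => ⟨rfl, h⟩)
      fun b hb => ?_)
    have hba : (b, a) ∈ I.R := hb.1.resolve_right fun h => h.1 rfl
    have hne : b ≠ a := by
      rintro rfl
      exact haa hba
    have hbA : b ∈ I.A := hb.2.1.resolve_right fun h => hne h.1
    by_contra hcon'
    exact hcon ⟨b, hbA, hba, fun c hc hcb => hcon' ⟨c, hc, choose_of_PR hcb hne
      (Or.inl (had.1 hc)) hb.2.1⟩⟩
  · rintro ⟨had, h⟩ B T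
    refine AF.mem_co.2 ⟨had.mem_ad B T, fun a ha hd => ?_⟩
    by_contra haS
    -- A self-attacking `a` could only be defended by a member of `S` attacking `a`; that member
    -- would have to be attacked from `S` too.
    by_cases haa : (a, a) ∈ I.R
    · obtain ⟨c, hc, hca⟩ := hd a (choose_of_R haa ha ha)
      obtain ⟨d, hdS, hdc⟩ := hd c hca
      exact had.2.1 d hdS c hc (PR_of_choose hdc)
    · obtain ⟨b, hb, hba, hS⟩ := h a (PA_of_choose ha) haS haa
      obtain ⟨c, hc, hcb⟩ := hd b (choose_of_R hba (Or.inl hb) ha)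
      exact hS c hc (PR_of_choose hcb)

theorem forall_gr_iff : (∀ B T, S ∈ (I.choose B T).gr) ↔ I.AlwaysCo S ∧
    ∀ X : Set α, (∀ a ∈ S, (∀ b ∈ I.PA, (b, a) ∈ I.PR → ∃ c ∈ X, (c, b) ∈ I.R) → a ∈ X) →
      S ⊆ X := by
  constructor
  · intro h
    have hco := forall_co_iff.1 fun B T => (AF.mem_gr.1 (h B T)).1
    refine ⟨hco, fun X hX => ?_⟩
    -- The hardest completion for `S`: all arguments, and exactly those uncertain attacks that hit
    -- `S`.
    have := (AF.mem_gr.1 (h Set.univ {r | r.2 ∈ S})).2 (X ∩ S)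
    refine (this fun a ha hd => ⟨hX a ha fun b hb hba => ?_, ha⟩).trans Set.inter_subset_left
    obtain ⟨c, hc, hcb⟩ := hd b (choose_of_PR hba ha (hb.imp_right fun h => ⟨trivial, h⟩)
      (Or.inl (hco.1.1 ha)))
    exact ⟨c, hc.1, hcb.1.resolve_right fun h => hco.1.2.1 c hc.2 b h.1 (Or.inr h.2)⟩
  · rintro ⟨hco, h⟩ B T
    refine AF.mem_gr.2 ⟨forall_co_iff.2 hco B T, fun X hX => ?_⟩
    refine (h (X ∩ S) fun a ha hd => ⟨hX a ha fun b hb => ?_, ha⟩).trans Set.inter_subset_left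
    obtain ⟨c, hc, hcb⟩ := hd b (PA_of_choose (T := T) hb.2.1) (PR_of_choose hb)
    exact ⟨c, hc.1, choose_of_R hcb (Or.inl (hco.1.1 hc.2)) hb.2.1⟩

end IAF

end Argumentation
end

noncomputable section

namespace StackMachine

open Function

/-! ### Derived connectives -/

namespace Fml

variable {n : ℕ} {l : List Sym} {ρ : Fin 4 → ℕ} {φ ψ : Fml}

def bit (t : List Skip) : Fml := sym (some true) t
def or (φ ψ : Fml) : Fml := neg (and (neg φ) (neg ψ))
def imp (φ ψ : Fml) : Fml := neg (and φ (neg ψ))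
def all (i : Fin 4) (φ : Fml) : Fml := neg (ex i (neg φ))

theorem eval_neg : (neg φ).eval n l ρ ↔ ¬ φ.eval n l ρ := Iff.rfl

theorem eval_and : (and φ ψ).eval n l ρ ↔ φ.eval n l ρ ∧ ψ.eval n l ρ := Iff.rfl

theorem eval_or : (or φ ψ).eval n l ρ ↔ φ.eval n l ρ ∨ ψ.eval n l ρ := by
  simp only [or, eval]
  tauto

theorem eval_imp : (imp φ ψ).eval n l ρ ↔ (φ.eval n l ρ → ψ.eval n l ρ) := by
  simp only [imp, eval]
  tauto

theorem eval_ex {i : Fin 4} :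
    (ex i φ).eval n l ρ ↔ ∃ a : Fin n, φ.eval n l (update ρ i a) := by
  simp only [eval]
  exact ⟨fun ⟨a, ha, h⟩ => ⟨⟨a, ha⟩, h⟩, fun ⟨a, h⟩ => ⟨a, a.2, h⟩⟩

theorem eval_all {i : Fin 4} :
    (all i φ).eval n l ρ ↔ ∀ a : Fin n, φ.eval n l (update ρ i a) := by
  rw [all, eval_neg, eval_ex, not_exists]
  exact forall_congr' fun a => not_not

theorem eval_sym {c : Sym} {t : List Skip} :
    (sym c t).eval n l ρ ↔ l[Skip.offset n ρ l t]? = some c := by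
  simp only [eval, List.head?_drop]

theorem eval_bit {t : List Skip} :
    (bit t).eval n l ρ ↔ l[Skip.offset n ρ l t]? = some (some true) := eval_sym

end Fml

/-! ### Addresses -/

section offset

variable {n : ℕ} {ρ : Fin 4 → ℕ}

theorem Skip.offset_append (t u : List Skip) : ∀ l, Skip.offset n ρ l (t ++ u) =
    Skip.offset n ρ l t + Skip.offset n ρ (l.drop (Skip.offset n ρ l t)) u := by
  induction t with
  | nil => simp [offset]
  | cons k t ih =>
    intro l
    simp only [List.cons_append, offset, ih, List.drop_drop]
    ring

theorem Skip.offset_replicate {k : Skip} {m : ℕ} (hk : ∀ l, k.len n ρ l = m) (j : ℕ) :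
    ∀ l, Skip.offset n ρ l (List.replicate j k) = j * m := by
  induction j with
  | zero => simp [offset]
  | succ j ih =>
    intro l
    simp only [List.replicate_succ, offset, ih, hk]
    ring

/-- An encoded word contains no separator, so the step `sep` skips exactly `w#`. -/
theorem eval_sym_sep {c : Sym} {t : List Skip} (w : List Bool) (r : List Sym) :
    (Fml.sym c (.sep :: t)).eval n (w.map some ++ none :: r) ρ ↔ (Fml.sym c t).eval n r ρ := by
  have h1 : ((w.map some ++ none :: r).takeWhile Option.isSome) = w.map some := by
    rw [List.takeWhile_append_of_pos fun a ha => by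
      obtain ⟨b, -, rfl⟩ := List.mem_map.1 ha
      rfl]
    simp
  have h2 : (w.map some ++ none :: r).drop (w.length + 1) = r := by
    rw [List.drop_append]
    simp
  simp only [Fml.eval, Skip.offset, Skip.len, h1, List.length_map, ← List.drop_drop, h2]

end offset

theorem getElem?_flatMap {β γ : Type} {f : β → List γ} {k : ℕ} (hk : ∀ b, (f b).length = k)
    {r : ℕ} (hr : r < k) : ∀ (l : List β) (i : ℕ) (hi : i < l.length),
    (l.flatMap f)[k * i + r]? = (f l[i])[r]? := by
  intro l
  induction l with
  | nil => intro i hi; simp at hi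
  | cons b l ih =>
    rintro (_ | i) hi
    · rw [List.flatMap_cons, List.getElem?_append_left (by rw [hk]; omega)]
      simp
    · rw [List.flatMap_cons, List.getElem?_append_right (by rw [hk]; nlinarith), hk,
        show k * (i + 1) + r - k = k * i + r by
          rw [mul_add, mul_one]; omega, ih i (by simpa using hi)]
      simp

theorem getElem?_flatMap_finRange {γ : Type} {n : ℕ} {f : Fin n → List γ} {k : ℕ}
    (hk : ∀ b, (f b).length = k) {r : ℕ} (hr : r < k) (a : Fin n) :
    ((List.finRange n).flatMap f)[k * a + r]? = (f a)[r]? := by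
  rw [getElem?_flatMap hk hr _ a (by simp)]
  simp

theorem length_flatMap_finRange {γ : Type} {n : ℕ} {f : Fin n → List γ} {k : ℕ}
    (hk : ∀ b, (f b).length = k) : ((List.finRange n).flatMap f).length = n * k := by
  simp [List.length_flatMap, hk]

/-! ### Unary relations as words -/

section relation

open Classical in
/-- The bits of a unary relation. -/
def relWord {n : ℕ} (T : Set (Fin n)) : List Sym :=
  (List.finRange n).map fun a => some (decide (a ∈ T))

theorem length_relWord {n : ℕ} (T : Set (Fin n)) : (relWord T).length = n := by simp [relWord]

theorem relWord_getElem? {n : ℕ} (T : Set (Fin n)) (a : Fin n) (l : List Sym) :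
    (relWord T ++ l)[(a : ℕ)]? = some (some true) ↔ a ∈ T := by
  rw [List.getElem?_append_left (by simp [relWord])]
  simp [relWord]

theorem round_relWord {n : ℕ} {φ : Fml} {l : List Sym} {f : Set (Fin n) → Set (Fin n)}
    (h : ∀ T (a : Fin n), φ.eval n (relWord T ++ l) (update 0 0 (a : ℕ)) ↔ a ∈ f T)
    (T : Set (Fin n)) : φ.round n l (relWord T) = relWord (f T) := by
  classical
  refine List.ext_getElem (by simp [Fml.round, relWord]) fun i h1 h2 => ?_
  have hi : i < n := by simpa [relWord] using h2
  have hr : (relWord (f T))[i] = some (decide (⟨i, hi⟩ ∈ f T)) := by simp [relWord]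
  simp only [hr, Fml.round, List.getElem_map, List.getElem_range]
  exact congrArg some (decide_eq_decide.2 (h T ⟨i, hi⟩))

theorem iterate_round {n : ℕ} {φ : Fml} {l : List Sym} {f : Set (Fin n) → Set (Fin n)}
    (h : ∀ T (a : Fin n), φ.eval n (relWord T ++ l) (update 0 0 (a : ℕ)) ↔ a ∈ f T) (j : ℕ) :
    (φ.round n l)^[j] (List.replicate n (some false)) = relWord (f^[j] ∅) := by
  induction j with
  | zero =>
    refine List.ext_getElem (by simp [relWord]) fun i h1 h2 => ?_
    simp [relWord]
  | succ j ih => rw [iterate_succ_apply', iterate_succ_apply', ih, round_relWord h]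

/-- The iteration of a monotone operator on the subsets of an `n`-element set reaches the least
fixed point after `n` steps. -/
theorem mem_iterate_iff {n : ℕ} {f : Set (Fin n) → Set (Fin n)} (hf : Monotone f) {a : Fin n} :
    a ∈ f^[n] ∅ ↔ ∀ X, f X ⊆ X → a ∈ X := by
  have hmono : Monotone fun k => f^[k] ∅ :=
    monotone_nat_of_le_succ fun k => by
      rw [iterate_succ_apply]
      exact hf.iterate k (Set.empty_subset _)
  -- The cardinalities of the increasing chain are at most `n` and remain constant once two
  -- neighbours agree, so they are stationary from `n` on.
  have hcard := Nat.stabilises_of_monotone (f := fun k => (f^[k] ∅).ncard) (b := n) (n := n + 1)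
    (fun i j hij => Set.ncard_le_ncard (hmono hij) (Set.toFinite _))
    (fun k => (Set.ncard_le_card _).trans (by simp))
    (fun k hk => by
      have := Set.eq_of_subset_of_ncard_le (hmono (Nat.le_succ k)) hk.ge (Set.toFinite _)
      simp only [Nat.succ_eq_add_one, iterate_succ_apply'] at this ⊢
      rw [← this, ← this])
    (Nat.le_succ n)
  have hfix : f (f^[n] ∅) = f^[n] ∅ := by
    have := Set.eq_of_subset_of_ncard_le (hmono (Nat.le_succ n)) hcard.le (Set.toFinite _)
    simp only [Nat.succ_eq_add_one, iterate_succ_apply'] at this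
    exact this.symm
  refine ⟨fun ha X hX => ?_, fun h => h _ hfix.le⟩
  have : ∀ k, f^[k] ∅ ⊆ X := by
    intro k
    induction k with
    | zero => exact Set.empty_subset _
    | succ k ih =>
      rw [iterate_succ_apply']
      exact (hf ih).trans hX
  exact this n ha

end relation

end StackMachine

/-! ### The bits of an instance -/

namespace Argumentation

open StackMachine Function

namespace Input

variable (x : Input)

/-- The word of an instance. -/
def word : List Sym := x.encode.map some

open Classical in
theorem encode_eq : x.encode = List.replicate x.n true ++ (false ::
    (decide (x.act = Action.addition) :: ((List.finRange x.n).flatMap (fun a =>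
    [decide (a ∈ x.I.A), decide (a ∈ x.I.Aq), decide (a ∈ x.S), decide (x.e = Element.arg a)]) ++
  (List.finRange x.n).flatMap (fun a => (List.finRange x.n).flatMap (fun b =>
    [decide ((a, b) ∈ x.I.R), decide ((a, b) ∈ x.I.Rq),
      decide (x.e = Element.att (a, b))]))))) := by
  simp only [encode, List.append_assoc, List.cons_append, List.nil_append]

theorem n_le_length : x.n ≤ x.encode.length := by
  rw [encode_eq]
  simp

theorem param_word (l : List Sym) : param (x.word ++ l) = x.n := by
  rw [param, word, encode_eq, List.map_append, List.append_assoc,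
    List.takeWhile_append_of_pos (by simp)]
  simp

open Classical in
theorem encode_act : x.encode[x.n + 1]? = some (decide (x.act = Action.addition)) := by
  rw [encode_eq, List.getElem?_append_right (by simp)]
  simp

open Classical in
theorem encode_unary (a : Fin x.n) {k : ℕ} (hk : k < 4) :
    x.encode[x.n + 2 + (4 * a + k)]? = [decide (a ∈ x.I.A), decide (a ∈ x.I.Aq),
      decide (a ∈ x.S), decide (x.e = Element.arg a)][k]? := by
  rw [encode_eq, List.getElem?_append_right (by simp; omega), List.length_replicate,
    show x.n + 2 + (4 * (a : ℕ) + k) - x.n = (4 * a + k) + 1 + 1 by omega,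
    List.getElem?_cons_succ, List.getElem?_cons_succ, List.getElem?_append_left,
    getElem?_flatMap_finRange (k := 4) (fun _ => rfl) hk]
  rw [length_flatMap_finRange (k := 4) fun _ => rfl]
  omega

-- Offsets: `n` ones, the closing zero and the action bit, then `4` bits per number, then `3` bits
-- per pair in row-major order.
open Classical in
theorem encode_binary (a b : Fin x.n) {k : ℕ} (hk : k < 3) :
    x.encode[x.n + 2 + (4 * x.n + (3 * (a * x.n) + (3 * b + k)))]? = [decide ((a, b) ∈ x.I.R),
      decide ((a, b) ∈ x.I.Rq), decide (x.e = Element.att (a, b))][k]? := by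
  have hlen := length_flatMap_finRange (n := x.n) (k := 4) (f := fun a =>
    [decide (a ∈ x.I.A), decide (a ∈ x.I.Aq), decide (a ∈ x.S), decide (x.e = Element.arg a)])
    fun _ => rfl
  have hlen' : ∀ a, ((List.finRange x.n).flatMap fun b => [decide ((a, b) ∈ x.I.R),
      decide ((a, b) ∈ x.I.Rq), decide (x.e = Element.att (a, b))]).length = x.n * 3 :=
    fun a => length_flatMap_finRange fun _ => rfl
  have hb := b.2
  rw [encode_eq, List.getElem?_append_right (by simp; omega), List.length_replicate,
    show ∀ m, x.n + 2 + m - x.n = m + 1 + 1 by omega,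
    List.getElem?_cons_succ, List.getElem?_cons_succ,
    List.getElem?_append_right (by rw [hlen]; omega), hlen,
    show 4 * x.n + (3 * ((a : ℕ) * x.n) + (3 * b + k)) - x.n * 4 = x.n * 3 * a + (3 * b + k) by
      rw [mul_comm x.n 4, Nat.add_sub_cancel_left]; ring,
    getElem?_flatMap_finRange hlen' (by omega),
    getElem?_flatMap_finRange (k := 3) (fun _ => rfl) hk]

/-- The memory `l` consists of the word of `x` and something more, with `d` unary relations in
front. -/
def InMemory (d : ℕ) (l : List Sym) : Prop :=
  ∃ pre suf : List Sym, pre.length = d * x.n ∧ l = pre ++ (x.word ++ suf)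

variable {x} {d : ℕ} {l : List Sym}

theorem inMemory_zero (suf : List Sym) : x.InMemory 0 (x.word ++ suf) := ⟨[], suf, by simp, rfl⟩

theorem InMemory.relWord (h : x.InMemory d l) (T : Set (Fin x.n)) :
    x.InMemory (d + 1) (relWord T ++ l) := by
  obtain ⟨pre, suf, hp, rfl⟩ := h
  refine ⟨StackMachine.relWord T ++ pre, suf, ?_, by simp⟩
  rw [List.length_append, length_relWord, hp]
  ring

theorem InMemory.getElem? (h : x.InMemory d l) {j : ℕ} {c : Bool} (hj : x.encode[j]? = some c) :
    l[d * x.n + j]? = some (some c) := by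
  obtain ⟨pre, suf, hp, rfl⟩ := h
  obtain ⟨hlt, -⟩ := List.getElem?_eq_some_iff.1 hj
  rw [List.getElem?_append_right (by omega), hp, Nat.add_sub_cancel_left,
    List.getElem?_append_left (by simpa [word] using hlt)]
  simp [word, hj]

end Input

/-- The bit for the action, with `d` unary relations in front of the word. -/
def fAct (d : ℕ) : Fml := .bit (List.replicate (d + 1) .num ++ [.one])

/-- The `k`-th bit for the number `i`. -/
def fUnary (k d : ℕ) (i : Fin 4) : Fml :=
  .bit (List.replicate (d + 1) .num ++ (List.replicate 2 .one ++ (List.replicate 4 (.var i) ++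
    List.replicate k .one)))

/-- The `k`-th bit for the pair of the numbers `i` and `j`. -/
def fBinary (k d : ℕ) (i j : Fin 4) : Fml :=
  .bit (List.replicate (d + 1) .num ++ (List.replicate 2 .one ++ (List.replicate 4 .num ++
    (List.replicate 3 (.row i) ++ (List.replicate 3 (.var j) ++ List.replicate k .one)))))

/-- The bit for the number `i` in the unary relation number `d`. -/
def fRel (d : ℕ) (i : Fin 4) : Fml := .bit (List.replicate d .num ++ [.var i])

section atoms

variable {x : Input} {d : ℕ} {l : List Sym} {ρ : Fin 4 → ℕ}

open Skip in
theorem offsets (n : ℕ) (ρ : Fin 4 → ℕ) (k : ℕ) (i : Fin 4) (l : List Sym) :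
    offset n ρ l (List.replicate k .one) = k * 1 ∧ offset n ρ l (List.replicate k .num) = k * n ∧
    offset n ρ l (List.replicate k (.var i)) = k * ρ i ∧
    offset n ρ l (List.replicate k (.row i)) = k * (ρ i * n) :=
  ⟨offset_replicate (fun _ => rfl) _ _, offset_replicate (fun _ => rfl) _ _,
    offset_replicate (fun _ => rfl) _ _, offset_replicate (fun _ => rfl) _ _⟩

theorem eval_fAct (h : x.InMemory d l) : (fAct d).eval x.n l ρ ↔ x.act = .addition := by
  have := h.getElem? x.encode_act
  rw [fAct, Fml.eval_bit, Skip.offset_append, (offsets _ _ _ 0 _).2.1]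
  simp only [Skip.offset, Skip.len]
  rw [show (d + 1) * x.n + (1 + 0) = d * x.n + (x.n + 1) by ring, this]
  simp

theorem eval_fUnary (h : x.InMemory d l) {k : ℕ} {i : Fin 4} (hi : ρ i < x.n)
    {p : Fin x.n → Prop} [DecidablePred p]
    (hp : x.encode[x.n + 2 + (4 * ((⟨ρ i, hi⟩ : Fin x.n) : ℕ) + k)]? = some (decide (p ⟨ρ i, hi⟩))) :
    (fUnary k d i).eval x.n l ρ ↔ p ⟨ρ i, hi⟩ := by
  have := h.getElem? hp
  rw [fUnary, Fml.eval_bit]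
  simp only [Skip.offset_append, (offsets _ _ _ 0 _).1, (offsets _ _ _ 0 _).2.1,
    (offsets _ _ _ _ _).2.2]
  rw [show (d + 1) * x.n + (2 * 1 + (4 * ρ i + k * 1)) = d * x.n + (x.n + 2 + (4 * ρ i + k)) by ring,
    this]
  simp

theorem eval_fBinary (h : x.InMemory d l) {k : ℕ} {i j : Fin 4} (hi : ρ i < x.n)
    (hj : ρ j < x.n) {p : Fin x.n → Fin x.n → Prop} [∀ a b, Decidable (p a b)]
    (hp : x.encode[x.n + 2 + (4 * x.n + (3 * (((⟨ρ i, hi⟩ : Fin x.n) : ℕ) * x.n) +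
      (3 * ((⟨ρ j, hj⟩ : Fin x.n) : ℕ) + k)))]? = some (decide (p ⟨ρ i, hi⟩ ⟨ρ j, hj⟩))) :
    (fBinary k d i j).eval x.n l ρ ↔ p ⟨ρ i, hi⟩ ⟨ρ j, hj⟩ := by
  have := h.getElem? hp
  rw [fBinary, Fml.eval_bit]
  simp only [Skip.offset_append, (offsets _ _ _ 0 _).1, (offsets _ _ _ 0 _).2.1,
    (offsets _ _ _ _ _).2.2]
  rw [show (d + 1) * x.n + (2 * 1 + (4 * x.n + (3 * (ρ i * x.n) + (3 * ρ j + k * 1)))) =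
    d * x.n + (x.n + 2 + (4 * x.n + (3 * (ρ i * x.n) + (3 * ρ j + k)))) by ring, this]
  simp

theorem eval_fA (h : x.InMemory d l) {i : Fin 4} (hi : ρ i < x.n) :
    (fUnary 0 d i).eval x.n l ρ ↔ ⟨ρ i, hi⟩ ∈ x.I.A := by
  classical
  exact eval_fUnary h hi (p := (· ∈ x.I.A)) (by rw [x.encode_unary _ (by omega)]; simp)

theorem eval_fAq (h : x.InMemory d l) {i : Fin 4} (hi : ρ i < x.n) :
    (fUnary 1 d i).eval x.n l ρ ↔ ⟨ρ i, hi⟩ ∈ x.I.Aq := by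
  classical
  exact eval_fUnary h hi (p := (· ∈ x.I.Aq)) (by rw [x.encode_unary _ (by omega)]; simp)

theorem eval_fS (h : x.InMemory d l) {i : Fin 4} (hi : ρ i < x.n) :
    (fUnary 2 d i).eval x.n l ρ ↔ ⟨ρ i, hi⟩ ∈ x.S := by
  classical
  exact eval_fUnary h hi (p := (· ∈ x.S)) (by rw [x.encode_unary _ (by omega)]; simp)

theorem eval_fArg (h : x.InMemory d l) {i : Fin 4} (hi : ρ i < x.n) :
    (fUnary 3 d i).eval x.n l ρ ↔ x.e = .arg ⟨ρ i, hi⟩ := by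
  classical
  exact eval_fUnary h hi (p := fun a => x.e = .arg a)
    (by rw [x.encode_unary _ (by omega)]; simp)

theorem eval_fR (h : x.InMemory d l) {i j : Fin 4} (hi : ρ i < x.n) (hj : ρ j < x.n) :
    (fBinary 0 d i j).eval x.n l ρ ↔ (⟨ρ i, hi⟩, ⟨ρ j, hj⟩) ∈ x.I.R := by
  classical
  exact eval_fBinary h hi hj (p := fun a b => (a, b) ∈ x.I.R)
    (by rw [x.encode_binary _ _ (by omega)]; simp)

theorem eval_fRq (h : x.InMemory d l) {i j : Fin 4} (hi : ρ i < x.n) (hj : ρ j < x.n) :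
    (fBinary 1 d i j).eval x.n l ρ ↔ (⟨ρ i, hi⟩, ⟨ρ j, hj⟩) ∈ x.I.Rq := by
  classical
  exact eval_fBinary h hi hj (p := fun a b => (a, b) ∈ x.I.Rq)
    (by rw [x.encode_binary _ _ (by omega)]; simp)

theorem eval_fAtt (h : x.InMemory d l) {i j : Fin 4} (hi : ρ i < x.n) (hj : ρ j < x.n) :
    (fBinary 2 d i j).eval x.n l ρ ↔ x.e = .att (⟨ρ i, hi⟩, ⟨ρ j, hj⟩) := by
  classical
  exact eval_fBinary h hi hj (p := fun a b => x.e = .att (a, b))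
    (by rw [x.encode_binary _ _ (by omega)]; simp)

theorem eval_fRel_zero {n : ℕ} {T : Set (Fin n)} {l : List Sym} {i : Fin 4} (hi : ρ i < n) :
    (fRel 0 i).eval n (relWord T ++ l) ρ ↔ ⟨ρ i, hi⟩ ∈ T := by
  rw [fRel, Fml.eval_bit, ← relWord_getElem? T ⟨ρ i, hi⟩ l]
  simp [Skip.offset, Skip.len]

theorem eval_fRel_one {n : ℕ} {T U : Set (Fin n)} {l : List Sym} {i : Fin 4} (hi : ρ i < n) :
    (fRel 1 i).eval n (relWord U ++ (relWord T ++ l)) ρ ↔ ⟨ρ i, hi⟩ ∈ T := by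
  rw [fRel, Fml.eval_bit, ← relWord_getElem? T ⟨ρ i, hi⟩ l]
  simp only [List.replicate_one, List.singleton_append, Skip.offset, Skip.len]
  rw [List.getElem?_append_right (by rw [length_relWord]; omega), length_relWord,
    Nat.add_sub_cancel_left, add_zero]

end atoms

/-! ### The instance after the opposite action -/

/-- The IAF that strong relevance is about: without the element if it is to be added, and with the
element if it is to be removed. -/
def Input.opposite (x : Input) : IAF (Fin x.n) :=
  match x.act with
  | .addition => x.I.remove x.e x.he
  | .removal => x.I.add x.e x.he

/-- Through `IAF.canReach_iff` the quantifier over partial completions and their stability collapses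
to one over completions. -/
theorem Input.stronglyRelevant_iff (x : Input) (j : Semantics × Bool) :
    StronglyRelevant x.I x.S j x.e x.he x.act ↔
      ¬ ∃ B T, HasStatus (x.opposite.choose B T) x.S j := by
  rw [← IAF.canReach_iff, IAF.CanReach, not_exists, Input.opposite]
  cases x.act <;> simp [StronglyRelevant]

def fS : ℕ → Fin 4 → Fml := fUnary 2

/-- Certain arguments after the opposite action. -/
def fA (d : ℕ) (i : Fin 4) : Fml := .or (fUnary 0 d i) (.and (.neg (fAct d)) (fUnary 3 d i))

/-- Possible arguments after the opposite action. -/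
def fPA (d : ℕ) (i : Fin 4) : Fml := .or (fA d i) (.and (fUnary 1 d i) (.neg (fUnary 3 d i)))

/-- The action does not exclude attacks between `i` and `j`. -/
def fKeep (d : ℕ) (i j : Fin 4) : Fml :=
  .imp (fAct d) (.and (.neg (fUnary 3 d i)) (.neg (fUnary 3 d j)))

/-- Certain attacks after the opposite action. -/
def fR (d : ℕ) (i j : Fin 4) : Fml :=
  .or (.and (fBinary 0 d i j) (fKeep d i j)) (.and (.neg (fAct d)) (fBinary 2 d i j))

/-- Uncertain attacks after the opposite action. -/
def fRq (d : ℕ) (i j : Fin 4) : Fml :=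
  .and (fBinary 1 d i j) (.and (.neg (fBinary 2 d i j)) (fKeep d i j))

/-- Possible attacks after the opposite action. -/
def fPR (d : ℕ) (i j : Fin 4) : Fml := .or (fR d i j) (fRq d i j)

/-! ### The IAF after the opposite action, as formulas -/

section atoms

variable {x : Input} {d : ℕ} {l : List Sym} {ρ : Fin 4 → ℕ}

theorem eval_opposite_A (h : x.InMemory d l) {i : Fin 4} (hi : ρ i < x.n) :
    (fA d i).eval x.n l ρ ↔ ⟨ρ i, hi⟩ ∈ x.opposite.A := by
  simp only [fA, Fml.eval_or, Fml.eval_and, Fml.eval_neg, eval_fA h hi, eval_fAct h,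
    eval_fArg h hi]
  generalize (⟨ρ i, hi⟩ : Fin x.n) = a
  obtain ⟨n, I, S, -, act, e, he⟩ := x
  rcases act with _ | _ <;> rcases e with _ | _ <;>
    simp [Input.opposite, IAF.add, IAF.remove, IAF.addArgs, IAF.addAttacks, IAF.removeArgs,
      IAF.removeAttacks, eq_comm]
  all_goals tauto

theorem eval_opposite_PA (h : x.InMemory d l) {i : Fin 4} (hi : ρ i < x.n) :
    (fPA d i).eval x.n l ρ ↔ ⟨ρ i, hi⟩ ∈ x.opposite.PA := by
  simp only [fPA, Fml.eval_or, Fml.eval_and, Fml.eval_neg, eval_opposite_A h hi, eval_fAq h hi,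
    eval_fArg h hi, IAF.mem_PA]
  generalize (⟨ρ i, hi⟩ : Fin x.n) = a
  refine or_congr_right ?_
  obtain ⟨n, I, S, -, act, e, he⟩ := x
  rcases act with _ | _ <;> rcases e with _ | _ <;>
    simp [Input.opposite, IAF.add, IAF.remove, IAF.addArgs, IAF.addAttacks, IAF.removeArgs,
      IAF.removeAttacks, eq_comm]

theorem eval_opposite_R (h : x.InMemory d l) {i j : Fin 4} (hi : ρ i < x.n) (hj : ρ j < x.n) :
    (fR d i j).eval x.n l ρ ↔ (⟨ρ i, hi⟩, ⟨ρ j, hj⟩) ∈ x.opposite.R := by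
  simp only [fR, fKeep, Fml.eval_or, Fml.eval_and, Fml.eval_neg, Fml.eval_imp, eval_fR h hi hj,
    eval_fAtt h hi hj, eval_fAct h, eval_fArg h hi, eval_fArg h hj]
  generalize (⟨ρ i, hi⟩ : Fin x.n) = a
  generalize (⟨ρ j, hj⟩ : Fin x.n) = b
  obtain ⟨n, I, S, -, act, e, he⟩ := x
  rcases act with _ | _ <;> rcases e with _ | _ <;>
    simp [Input.opposite, IAF.add, IAF.remove, IAF.addArgs, IAF.addAttacks, IAF.removeArgs,
      IAF.removeAttacks, IAF.attacksAt, eq_comm]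
  all_goals tauto

theorem eval_opposite_Rq (h : x.InMemory d l) {i j : Fin 4} (hi : ρ i < x.n) (hj : ρ j < x.n) :
    (fRq d i j).eval x.n l ρ ↔ (⟨ρ i, hi⟩, ⟨ρ j, hj⟩) ∈ x.opposite.Rq := by
  simp only [fRq, fKeep, Fml.eval_and, Fml.eval_neg, Fml.eval_imp, eval_fRq h hi hj,
    eval_fAtt h hi hj, eval_fAct h, eval_fArg h hi, eval_fArg h hj]
  generalize (⟨ρ i, hi⟩ : Fin x.n) = a
  generalize (⟨ρ j, hj⟩ : Fin x.n) = b
  obtain ⟨n, I, S, -, act, e, he⟩ := x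
  rcases act with _ | _ <;> rcases e with _ | _ <;>
    simp [Input.opposite, IAF.add, IAF.remove, IAF.addArgs, IAF.addAttacks, IAF.removeArgs,
      IAF.removeAttacks, IAF.attacksAt, eq_comm]
  all_goals tauto

theorem eval_opposite_PR (h : x.InMemory d l) {i j : Fin 4} (hi : ρ i < x.n) (hj : ρ j < x.n) :
    (fPR d i j).eval x.n l ρ ↔ (⟨ρ i, hi⟩, ⟨ρ j, hj⟩) ∈ x.opposite.PR := by
  rw [fPR, Fml.eval_or, eval_opposite_R h hi hj, eval_opposite_Rq h hi hj]
  rfl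

end atoms

end Argumentation
end

noncomputable section

namespace Argumentation

open StackMachine Function Fml

/-! ### Queries for the polynomial cases -/

section formulas

variable (d : ℕ)

def fCompatible : Fml :=
  .and (.all 0 (.imp (fS d 0) (fPA d 0)))
    (.all 0 (.imp (fS d 0) (.all 1 (.imp (fS d 1) (.neg (fR d 0 1))))))

def fDefensible : Fml :=
  .all 0 (.imp (fS d 0) (.all 1 (.imp (fA d 1) (.imp (fR d 1 0)
    (.ex 2 (.and (fS d 2) (fPR d 2 1)))))))

def fPossibleAd : Fml := .and (fCompatible d) (fDefensible d)

def fPossibleSt : Fml :=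
  .and (fCompatible d) (.all 0 (.imp (fA d 0) (.imp (.neg (fS d 0))
    (.ex 1 (.and (fS d 1) (fPR d 1 0))))))

/-- The operator whose least fixed point consists of the arguments that cannot be undecided. -/
def fDecided : Fml :=
  .neg (.and (fPA d 0) (.and (.neg (fS d 0)) (.and
    (.all 1 (.imp (fS d 1) (.and (.neg (fR d 1 0)) (.neg (fR d 0 1)))))
    (.ex 1 (.and (.neg (fRel 0 1)) (fPR d 1 0))))))

/-- The parameter `k` locates the relation computed by `fDecided`, which moves back when another
relation is put in front. -/
def fPossibleCo (k : ℕ) : Fml :=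
  .and (fCompatible d) (.and (fDefensible d) (.all 0 (.imp (fA d 0) (.imp (.neg (fS d 0))
    (.or (.neg (fRel k 0)) (.ex 1 (.and (fS d 1) (fPR d 1 0))))))))

def fPossiblyGrounded : Fml :=
  .and (fS d 0) (.all 1 (.imp (fA d 1) (.imp (fR d 1 0) (.ex 2 (.and (fRel 0 2) (fPR d 2 1))))))

def fSubsetRel : Fml := .all 0 (.imp (fS d 0) (fRel 0 0))

def fAlwaysAd : Fml :=
  .and (.all 0 (.imp (fS d 0) (fA d 0))) (.and
    (.all 0 (.imp (fS d 0) (.all 1 (.imp (fS d 1) (.neg (fPR d 0 1))))))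
    (.all 0 (.imp (fS d 0) (.all 1 (.imp (fPA d 1) (.imp (fPR d 1 0)
      (.ex 2 (.and (fS d 2) (fR d 2 1)))))))))

def fAlwaysSt : Fml :=
  .and (.all 0 (.imp (fS d 0) (fA d 0))) (.and
    (.all 0 (.imp (fS d 0) (.all 1 (.imp (fS d 1) (.neg (fPR d 0 1))))))
    (.all 0 (.imp (fPA d 0) (.imp (.neg (fS d 0)) (.ex 1 (.and (fS d 1) (fR d 1 0)))))))

def fAlwaysCo : Fml :=
  .and (fAlwaysAd d) (.all 0 (.imp (fPA d 0) (.imp (.neg (fS d 0)) (.imp (.neg (fR d 0 0))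
    (.ex 1 (.and (fA d 1) (.and (fR d 1 0) (.all 2 (.imp (fS d 2) (.neg (fPR d 2 1)))))))))))

def fAlwaysGrounded : Fml :=
  .and (fS d 0) (.all 1 (.imp (fPA d 1) (.imp (fPR d 1 0) (.ex 2 (.and (fRel 0 2) (fR d 2 1))))))

end formulas

/-! ### Meaning of the formulas and their operators -/

section eval

variable {x : Input} {d : ℕ} {l : List StackMachine.Sym} {ρ : Fin 4 → ℕ}

theorem eval_S (h : x.InMemory d l) {i : Fin 4} (hi : ρ i < x.n) :
    (fS d i).eval x.n l ρ ↔ ⟨ρ i, hi⟩ ∈ x.S := eval_fS h hi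

theorem eval_fCompatible (h : x.InMemory d l) :
    (fCompatible d).eval x.n l ρ ↔ x.opposite.Compatible x.S := by
  simp [fCompatible, IAF.Compatible, Set.subset_def, eval_and, eval_imp, eval_all, eval_neg,
    eval_S h, eval_opposite_PA h, eval_opposite_R h]

theorem eval_fDefensible (h : x.InMemory d l) : (fDefensible d).eval x.n l ρ ↔
    ∀ a ∈ x.S, ∀ b ∈ x.opposite.A, (b, a) ∈ x.opposite.R → ∃ c ∈ x.S, (c, b) ∈ x.opposite.PR := by
  simp [fDefensible, eval_and, eval_imp, eval_all, eval_ex,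
    eval_S h, eval_opposite_A h, eval_opposite_R h, eval_opposite_PR h]

theorem eval_fPossibleSt (h : x.InMemory d l) : (fPossibleSt d).eval x.n l ρ ↔
    x.opposite.Compatible x.S ∧
      ∀ a ∈ x.opposite.A, a ∉ x.S → ∃ c ∈ x.S, (c, a) ∈ x.opposite.PR := by
  simp [fPossibleSt, eval_fCompatible h, eval_and, eval_imp, eval_all, eval_ex, eval_neg,
    eval_S h, eval_opposite_A h, eval_opposite_PR h]

theorem eval_fAlwaysAd (h : x.InMemory d l) :
    (fAlwaysAd d).eval x.n l ρ ↔ x.opposite.AlwaysAd x.S := by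
  simp [fAlwaysAd, IAF.AlwaysAd, Set.subset_def, eval_and, eval_imp, eval_all, eval_ex, eval_neg,
    eval_S h, eval_opposite_A h, eval_opposite_PA h, eval_opposite_R h, eval_opposite_PR h]

theorem eval_fAlwaysSt (h : x.InMemory d l) : (fAlwaysSt d).eval x.n l ρ ↔
    x.S ⊆ x.opposite.A ∧ (∀ a ∈ x.S, ∀ b ∈ x.S, (a, b) ∉ x.opposite.PR) ∧
      ∀ a ∈ x.opposite.PA, a ∉ x.S → ∃ c ∈ x.S, (c, a) ∈ x.opposite.R := by
  simp [fAlwaysSt, Set.subset_def, eval_and, eval_imp, eval_all, eval_ex, eval_neg,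
    eval_S h, eval_opposite_A h, eval_opposite_PA h, eval_opposite_R h, eval_opposite_PR h]

theorem eval_fAlwaysCo (h : x.InMemory d l) :
    (fAlwaysCo d).eval x.n l ρ ↔ x.opposite.AlwaysCo x.S := by
  simp [fAlwaysCo, IAF.AlwaysCo, eval_fAlwaysAd h, eval_and, eval_imp, eval_all, eval_ex, eval_neg,
    eval_S h, eval_opposite_A h, eval_opposite_PA h, eval_opposite_R h, eval_opposite_PR h]

/-- The operator of `fDecided`. -/
def decidedOp (x : Input) (T : Set (Fin x.n)) : Set (Fin x.n) :=
  {a | ¬ (a ∈ x.opposite.PA ∧ a ∉ x.S ∧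
    (∀ s ∈ x.S, (s, a) ∉ x.opposite.R ∧ (a, s) ∉ x.opposite.R) ∧
    ∃ b, b ∉ T ∧ (b, a) ∈ x.opposite.PR)}

theorem decidedOp_monotone (x : Input) : Monotone (decidedOp x) := by
  intro T U hTU a ha ⟨h1, h2, h3, b, hb, hba⟩
  exact ha ⟨h1, h2, h3, b, fun h => hb (hTU h), hba⟩

/-- Undecided sets are exactly the complements of the sets closed under `decidedOp`. Queries offer
least fixed points, so the largest undecided set is obtained as a complement. -/
theorem notMem_iterate_decidedOp {a : Fin x.n} :
    a ∉ (decidedOp x)^[x.n] ∅ ↔ ∃ U, x.opposite.Undecided x.S U ∧ a ∈ U := by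
  rw [mem_iterate_iff (decidedOp_monotone x)]
  push Not
  constructor
  · rintro ⟨X, hX, ha⟩
    refine ⟨Xᶜ, fun u hu => ?_, ha⟩
    have : ¬ u ∈ decidedOp x X := fun h => hu (hX h)
    simp only [decidedOp, Set.mem_ofPred_eq, not_not] at this
    exact this
  · rintro ⟨U, hU, ha⟩
    refine ⟨Uᶜ, fun u hu huU => hu ?_, fun h => h ha⟩
    obtain ⟨h1, h2, h3, b, hb, hbu⟩ := hU u huU
    exact ⟨h1, h2, h3, b, fun h => h hb, hbu⟩

theorem eval_fDecided (h : x.InMemory d l) (T : Set (Fin x.n)) (a : Fin x.n) :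
    (fDecided (d + 1)).eval x.n (relWord T ++ l) (update 0 0 (a : ℕ)) ↔ a ∈ decidedOp x T := by
  have h' := h.relWord T
  simp only [fDecided, decidedOp, Set.mem_ofPred_eq, eval_neg]
  refine not_congr ?_
  simp [eval_and, eval_imp, eval_all, eval_ex, eval_neg, eval_fRel_zero,
    eval_S h', eval_opposite_PA h', eval_opposite_R h', eval_opposite_PR h']

/-- The operator of `fPossiblyGrounded`. -/
def possiblyGroundedOp (x : Input) (T : Set (Fin x.n)) : Set (Fin x.n) :=
  {a | a ∈ x.S ∧ ∀ b ∈ x.opposite.A, (b, a) ∈ x.opposite.R → ∃ c ∈ T, (c, b) ∈ x.opposite.PR}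

theorem possiblyGroundedOp_monotone (x : Input) : Monotone (possiblyGroundedOp x) :=
  fun _ _ hTU _ ha => ⟨ha.1, fun b hb hba =>
    let ⟨c, hc, hcb⟩ := ha.2 b hb hba
    ⟨c, hTU hc, hcb⟩⟩

theorem eval_fPossiblyGrounded (h : x.InMemory d l) (T : Set (Fin x.n)) (a : Fin x.n) :
    (fPossiblyGrounded (d + 1)).eval x.n (relWord T ++ l) (update 0 0 (a : ℕ)) ↔
      a ∈ possiblyGroundedOp x T := by
  have h' := h.relWord T
  simp [fPossiblyGrounded, possiblyGroundedOp, eval_and, eval_imp, eval_all, eval_ex,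
    eval_fRel_zero, eval_S h', eval_opposite_A h', eval_opposite_R h', eval_opposite_PR h']

/-- The operator of `fAlwaysGrounded`. -/
def alwaysGroundedOp (x : Input) (T : Set (Fin x.n)) : Set (Fin x.n) :=
  {a | a ∈ x.S ∧ ∀ b ∈ x.opposite.PA, (b, a) ∈ x.opposite.PR → ∃ c ∈ T, (c, b) ∈ x.opposite.R}

theorem alwaysGroundedOp_monotone (x : Input) : Monotone (alwaysGroundedOp x) :=
  fun _ _ hTU _ ha => ⟨ha.1, fun b hb hba =>
    let ⟨c, hc, hcb⟩ := ha.2 b hb hba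
    ⟨c, hTU hc, hcb⟩⟩

theorem eval_fAlwaysGrounded (h : x.InMemory d l) (T : Set (Fin x.n)) (a : Fin x.n) :
    (fAlwaysGrounded (d + 1)).eval x.n (relWord T ++ l) (update 0 0 (a : ℕ)) ↔
      a ∈ alwaysGroundedOp x T := by
  have h' := h.relWord T
  simp [fAlwaysGrounded, alwaysGroundedOp, eval_and, eval_imp, eval_all, eval_ex,
    eval_fRel_zero, eval_S h', eval_opposite_PA h', eval_opposite_R h', eval_opposite_PR h']

theorem eval_fSubsetRel (h : x.InMemory d l) (T : Set (Fin x.n)) :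
    (fSubsetRel (d + 1)).eval x.n (relWord T ++ l) ρ ↔ x.S ⊆ T := by
  have h' := h.relWord T
  simp [fSubsetRel, Set.subset_def, eval_imp, eval_all, eval_fRel_zero, eval_S h']

theorem subset_iterate_iff {n : ℕ} {S : Set (Fin n)} {p : Fin n → Set (Fin n) → Prop}
    (hf : Monotone fun T => {a | a ∈ S ∧ p a T}) :
    S ⊆ (fun T => {a | a ∈ S ∧ p a T})^[n] ∅ ↔ ∀ X, (∀ a ∈ S, p a X → a ∈ X) → S ⊆ X := by
  constructor
  · intro h X hX a ha
    exact (mem_iterate_iff hf).1 (h ha) X fun b hb => hX b hb.1 hb.2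
  · intro h a ha
    exact (mem_iterate_iff hf).2 fun X hX => h X (fun b hb hpb => hX ⟨hb, hpb⟩) ha

theorem eval_fPossibleCo {k : ℕ} (h : x.InMemory d l)
    (hk : ∀ {ρ : Fin 4 → ℕ} {i : Fin 4} (hi : ρ i < x.n),
      (fRel k i).eval x.n l ρ ↔ ⟨ρ i, hi⟩ ∈ (decidedOp x)^[x.n] ∅) :
    (fPossibleCo d k).eval x.n l ρ ↔ x.opposite.Compatible x.S ∧ x.opposite.CoCond x.S := by
  simp [fPossibleCo, IAF.CoCond, eval_fCompatible h, eval_fDefensible h, eval_and, eval_or,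
    eval_imp, eval_all, eval_ex, eval_neg, eval_S h, eval_opposite_A h, eval_opposite_PR h, hk,
    notMem_iterate_decidedOp]

end eval

/-- The query that decides `(σ, b)`-strong relevance. -/
def relevanceQuery : Semantics → Bool → Query
  | .ad, true => .ret (.neg (fPossibleAd 0))
  | .st, true => .ret (.neg (fPossibleSt 0))
  | .co, true => .fix (fDecided 1) (.ret (.neg (fPossibleCo 1 0)))
  | .gr, true => .fix (fDecided 1) (.fix (fPossiblyGrounded 2)
      (.ret (.neg (.and (fPossibleCo 2 1) (fSubsetRel 2)))))
  | .ad, false => .ret (fAlwaysAd 0)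
  | .st, false => .ret (fAlwaysSt 0)
  | .co, false => .ret (fAlwaysCo 0)
  | .gr, false => .fix (fAlwaysGrounded 1) (.ret (.and (fAlwaysCo 1) (fSubsetRel 1)))
  | .pr, _ => .ret (.neg (fPossibleAd 0))

theorem relevanceQuery_wellScoped (σ : Semantics) (b : Bool) :
    (relevanceQuery σ b).wellScoped = true := by
  cases σ <;> cases b <;> decide

theorem not_exists_not {α β : Type} {p : α → β → Prop} :
    (¬ ∃ B T, ¬ p B T) ↔ ∀ B T, p B T := by
  push Not
  rfl

/-- For `true` the query negates possible extensionhood; for `false` the two negations cancel and it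
tests extensionhood in all completions. -/
theorem relevanceQuery_holds {σ : Semantics} (hσ : σ ≠ .pr) (b : Bool) (x : Input) :
    (relevanceQuery σ b).holds x.word ↔
      ¬ ∃ B T, HasStatus (x.opposite.choose B T) x.S (σ, b) := by
  have h : x.InMemory 0 x.word := by simpa using Input.inMemory_zero (x := x) []
  have hn : param x.word = x.n := by simpa using x.param_word []
  rw [Query.holds, hn]
  have hdec := iterate_round (l := x.word) (eval_fDecided h) x.n
  have halw := iterate_round (l := x.word) (eval_fAlwaysGrounded h) x.n
  cases σ with
  | pr => exact absurd rfl hσ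
  | ad =>
    cases b with
    | true =>
      exact not_congr ((and_congr (eval_fCompatible h) (eval_fDefensible h)).trans
        IAF.exists_ad_iff.symm)
    | false => exact (eval_fAlwaysAd h).trans (IAF.forall_ad_iff.symm.trans not_exists_not.symm)
  | st =>
    cases b with
    | true => exact not_congr ((eval_fPossibleSt h).trans IAF.exists_st_iff.symm)
    | false => exact (eval_fAlwaysSt h).trans (IAF.forall_st_iff.symm.trans not_exists_not.symm)
  | co =>
    cases b with
    | true =>
      simp only [relevanceQuery, Query.eval, hdec]
      exact not_congr ((eval_fPossibleCo (h.relWord _) eval_fRel_zero).trans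
        IAF.exists_co_iff.symm)
    | false => exact (eval_fAlwaysCo h).trans (IAF.forall_co_iff.symm.trans not_exists_not.symm)
  | gr =>
    cases b with
    | true =>
      have h1 := h.relWord ((decidedOp x)^[x.n] ∅)
      have hgr := iterate_round (eval_fPossiblyGrounded h1) x.n
      simp only [relevanceQuery, Query.eval, hdec, hgr]
      refine not_congr (Iff.trans (and_congr ?_ ?_) IAF.exists_gr_iff.symm)
      · exact eval_fPossibleCo (h1.relWord _) eval_fRel_one
      · exact (eval_fSubsetRel h1 _).trans (subset_iterate_iff (possiblyGroundedOp_monotone x))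
    | false =>
      simp only [relevanceQuery, Query.eval, halw]
      refine Iff.trans (and_congr ?_ ?_) (IAF.forall_gr_iff.symm.trans not_exists_not.symm)
      · exact eval_fAlwaysCo (h.relWord _)
      · exact (eval_fSubsetRel h _).trans (subset_iterate_iff (alwaysGroundedOp_monotone x))

/-- A language that answers correctly for every input solves the problem with restricted inputs. -/
theorem strongRelevance_inClass {j : Semantics × Bool} {C : Set (Set (List Bool))}
    {L : Set (List Bool)} (hL : L ∈ C)
    (h : ∀ x : Input, x.encode ∈ L ↔ ¬ ∃ B T, HasStatus (x.opposite.choose B T) x.S j) :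
    (strongRelevance j).InClass C := by
  refine ⟨L, hL, ?_, ?_⟩
  · rintro _ ⟨x, rfl, -, hx⟩
    exact (h x).2 ((x.stronglyRelevant_iff j).1 hx)
  · rintro _ ⟨x, rfl, -, hx⟩ hmem
    exact hx ((x.stronglyRelevant_iff j).2 ((h x).1 hmem))

theorem strongRelevance_mem_P {σ : Semantics} (hσ : σ ≠ .pr) (b : Bool) :
    (strongRelevance (σ, b)).InClass Complexity.ClassP :=
  strongRelevance_inClass (L := {w | (relevanceQuery σ b).holds (w.map some)})
    ((relevanceQuery σ b).polyTimeDecidable (relevanceQuery_wellScoped σ b) _ some)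
    (relevanceQuery_holds hσ b)

/-! ### Certificates for the preferred semantics -/

section certificates

variable {n : ℕ}

/-- The sets of arguments, candidate set and attacks that are described by a certificate. -/
def certArgs (n : ℕ) (r : List StackMachine.Sym) : Set (Fin n) :=
  {a | r[(a : ℕ)]? = some (some true)}

def certSet (n : ℕ) (r : List StackMachine.Sym) : Set (Fin n) :=
  {a | r[n + (a : ℕ)]? = some (some true)}

def certAtts (n : ℕ) (r : List StackMachine.Sym) : Set (Fin n × Fin n) :=
  {p | r[n + (n + (p.1 * n + p.2))]? = some (some true)}

theorem exists_bits (B : Set (Fin n)) : ∃ z : List Bool, z.length = n ∧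
    ∀ a : Fin n, z[(a : ℕ)]? = some true ↔ a ∈ B := by
  classical
  exact ⟨(List.finRange n).map fun a => decide (a ∈ B), by simp, fun a => by simp⟩

theorem exists_certificate (B T : Set (Fin n)) (R : Set (Fin n × Fin n)) :
    ∃ y : List Bool, y.length = n + (n + n * n) ∧ ∀ s, certArgs n (y.map some ++ s) = B ∧
      certSet n (y.map some ++ s) = T ∧ certAtts n (y.map some ++ s) = R := by
  classical
  obtain ⟨u, hu, hu'⟩ := exists_bits B
  obtain ⟨v, hv, hv'⟩ := exists_bits T
  set f : Fin n → List Bool := fun a => (List.finRange n).map fun b => decide ((a, b) ∈ R) with hf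
  set w : List Bool := (List.finRange n).flatMap f with hw
  have hfn : ∀ a, (f a).length = n := fun a => by simp [hf]
  have hwn : w.length = n * n := length_flatMap_finRange hfn
  refine ⟨u ++ (v ++ w), by simp [hu, hv, hwn], fun s => ⟨?_, ?_, ?_⟩⟩
  · ext a
    rw [← hu' a, certArgs, Set.mem_ofPred_eq, List.getElem?_append_left (by simp [hu]; omega),
      List.getElem?_map, List.getElem?_append_left (by omega)]
    simp
  · ext a
    rw [← hv' a, certSet, Set.mem_ofPred_eq, List.getElem?_append_left (by simp [hu, hv]; omega),
      List.getElem?_map, List.getElem?_append_right (by omega), hu, Nat.add_sub_cancel_left,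
      List.getElem?_append_left (by omega)]
    simp
  · ext ⟨a, b⟩
    have hlt : (a : ℕ) * n + b < n * n := by
      have := a.2
      have := b.2
      nlinarith
    rw [certAtts, Set.mem_ofPred_eq, List.getElem?_append_left (by simp [hu, hv, hwn, hlt]),
      List.getElem?_map, List.getElem?_append_right (by omega), hu, Nat.add_sub_cancel_left,
      List.getElem?_append_right (by omega), hv, Nat.add_sub_cancel_left, mul_comm (a : ℕ) n, hw,
      getElem?_flatMap_finRange hfn b.2]
    simp [hf]

/-- In a triple the certificate is followed by the challenge. If it were too short, its missing bits
would be read from there, and the completion could depend on the challenge; `fLong` excludes this.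
-/
theorem cert_append {y : List Bool} (hy : n + (n + n * n) ≤ y.length)
    (s : List StackMachine.Sym) : certArgs n (y.map some ++ s) = certArgs n (y.map some) ∧
      certAtts n (y.map some ++ s) = certAtts n (y.map some) := by
  constructor
  · ext a
    rw [certArgs, Set.mem_ofPred_eq, List.getElem?_append_left (by simp; omega)]
    rfl
  · ext ⟨a, b⟩
    have hlt : (a : ℕ) * n + b < n * n := by
      have := a.2
      have := b.2
      nlinarith
    rw [certAtts, Set.mem_ofPred_eq, List.getElem?_append_left (by simp; omega)]
    rfl

end certificates

/-! ### Formulas about an instance with certificates -/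

section formulas

def fCertArg (i : Fin 4) : Fml := .bit [.sep, .var i]

def fCertSet (i : Fin 4) : Fml := .bit [.sep, .num, .var i]

def fCertAtt (i j : Fin 4) : Fml := .bit [.sep, .num, .num, .row i, .var j]

def fChallenge (i : Fin 4) : Fml := .bit [.sep, .sep, .var i]

/-- Arguments of the completion that is described by the certificate. -/
def fChooseA (i : Fin 4) : Fml := .or (fA 0 i) (.and (fCertArg i) (fPA 0 i))

/-- Attacks of the completion that is described by the certificate. -/
def fChooseR (i j : Fin 4) : Fml :=
  .and (.or (fR 0 i j) (.and (fCertAtt i j) (fPR 0 i j))) (.and (fChooseA i) (fChooseA j))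

/-- The set given by `s` is admissible. -/
def fAdmissible (s : Fin 4 → Fml) : Fml :=
  .and (.all 0 (.imp (s 0) (fChooseA 0))) (.and
    (.all 0 (.imp (s 0) (.all 1 (.imp (s 1) (.neg (fChooseR 0 1))))))
    (.all 0 (.imp (s 0) (.all 1 (.imp (fChooseR 1 0) (.ex 2 (.and (s 2) (fChooseR 2 1))))))))

/-- The set given by `s` is an admissible proper superset of `S`. -/
def fImproves (s : Fin 4 → Fml) : Fml :=
  .and (fAdmissible s) (.and (.all 0 (.imp (fS 0 0) (s 0))) (.ex 0 (.and (s 0) (.neg (fS 0 0)))))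

/-- The certificate does not end too early. -/
def fLong : Fml :=
  .and (.all 0 (.neg (.sym none [.sep, .var 0]))) (.and
    (.all 0 (.neg (.sym none [.sep, .num, .var 0])))
    (.all 0 (.all 1 (.neg (.sym none [.sep, .num, .num, .row 0, .var 1])))))

/-- No length test is needed: nothing follows the certificate, missing bits count as `0`, and any
word describes some completion and set. -/
def notPreferredQuery : Query := .ret (.or (.neg (fAdmissible (fS 0))) (fImproves fCertSet))

def preferredQuery : Query :=
  .ret (.and fLong (.and (fAdmissible (fS 0)) (.neg (fImproves fChallenge))))

end formulas

section eval

variable {x : Input} {r : List StackMachine.Sym} {ρ : Fin 4 → ℕ}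

theorem eval_fCertArg {i : Fin 4} (hi : ρ i < x.n) :
    (fCertArg i).eval x.n (x.word ++ none :: r) ρ ↔ ⟨ρ i, hi⟩ ∈ certArgs x.n r := by
  rw [fCertArg, bit, Input.word, eval_sym_sep, eval_sym]
  rfl

theorem eval_fCertSet {i : Fin 4} (hi : ρ i < x.n) :
    (fCertSet i).eval x.n (x.word ++ none :: r) ρ ↔ ⟨ρ i, hi⟩ ∈ certSet x.n r := by
  rw [fCertSet, bit, Input.word, eval_sym_sep, eval_sym]
  rfl

theorem eval_fCertAtt {i j : Fin 4} (hi : ρ i < x.n) (hj : ρ j < x.n) :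
    (fCertAtt i j).eval x.n (x.word ++ none :: r) ρ ↔
      (⟨ρ i, hi⟩, ⟨ρ j, hj⟩) ∈ certAtts x.n r := by
  rw [fCertAtt, bit, Input.word, eval_sym_sep, eval_sym]
  rfl

theorem eval_fChallenge {y : List Bool} {i : Fin 4} (hi : ρ i < x.n) :
    (fChallenge i).eval x.n (x.word ++ none :: (y.map some ++ none :: r)) ρ ↔
      ⟨ρ i, hi⟩ ∈ certArgs x.n r := by
  rw [fChallenge, bit, Input.word, eval_sym_sep, eval_sym_sep, eval_sym]
  rfl

theorem eval_fChooseA {i : Fin 4} (hi : ρ i < x.n) :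
    (fChooseA i).eval x.n (x.word ++ none :: r) ρ ↔
      ⟨ρ i, hi⟩ ∈ (x.opposite.choose (certArgs x.n r) (certAtts x.n r)).A := by
  have h := Input.inMemory_zero (x := x) (none :: r)
  rw [fChooseA, eval_or, eval_and, eval_opposite_A h hi, eval_opposite_PA h hi, eval_fCertArg hi,
    IAF.mem_choose_A, IAF.mem_PA]
  tauto

theorem eval_fChooseR {i j : Fin 4} (hi : ρ i < x.n) (hj : ρ j < x.n) :
    (fChooseR i j).eval x.n (x.word ++ none :: r) ρ ↔ (⟨ρ i, hi⟩, ⟨ρ j, hj⟩) ∈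
      (x.opposite.choose (certArgs x.n r) (certAtts x.n r)).R := by
  have h := Input.inMemory_zero (x := x) (none :: r)
  rw [fChooseR, eval_and, eval_and, eval_or, eval_and, eval_opposite_R h hi hj,
    eval_opposite_PR h hi hj, eval_fCertAtt hi hj, eval_fChooseA hi, eval_fChooseA hj,
    IAF.mem_choose_R, IAF.mem_PR]
  tauto

theorem eval_fAdmissible {s : Fin 4 → Fml} {T : Set (Fin x.n)}
    (hs : ∀ {ρ : Fin 4 → ℕ} {i : Fin 4} (hi : ρ i < x.n),
      (s i).eval x.n (x.word ++ none :: r) ρ ↔ ⟨ρ i, hi⟩ ∈ T) :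
    (fAdmissible s).eval x.n (x.word ++ none :: r) ρ ↔
      T ∈ (x.opposite.choose (certArgs x.n r) (certAtts x.n r)).ad := by
  rw [AF.mem_ad]
  simp [fAdmissible, Set.subset_def, eval_and, eval_imp, eval_all, eval_ex, eval_neg, hs,
    eval_fChooseA, eval_fChooseR]

theorem eval_fImproves {s : Fin 4 → Fml} {T : Set (Fin x.n)}
    (hs : ∀ {ρ : Fin 4 → ℕ} {i : Fin 4} (hi : ρ i < x.n),
      (s i).eval x.n (x.word ++ none :: r) ρ ↔ ⟨ρ i, hi⟩ ∈ T) :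
    (fImproves s).eval x.n (x.word ++ none :: r) ρ ↔
      T ∈ (x.opposite.choose (certArgs x.n r) (certAtts x.n r)).ad ∧ x.S ⊆ T ∧ ¬ T ⊆ x.S := by
  have h := Input.inMemory_zero (x := x) (none :: r)
  simp [fImproves, Set.subset_def, eval_fAdmissible hs, eval_and, eval_imp,
    eval_all, eval_ex, eval_neg, hs, eval_S h]

/-- The first separator is at position `y.length`, and the three clauses cover all positions below
`n + (n + n * n)`. -/
theorem eval_fLong {y : List Bool} {s : List StackMachine.Sym} :
    fLong.eval x.n (x.word ++ none :: (y.map some ++ none :: s)) ρ ↔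
      x.n + (x.n + x.n * x.n) ≤ y.length := by
  have hsym : ∀ k, (y.map some ++ none :: s)[k]? = some none → y.length ≤ k := by
    intro k hk
    by_contra hlt
    rw [List.getElem?_append_left (by simpa using hlt)] at hk
    simp at hk
  have hlen : (y.map some ++ none :: s)[y.length]? = some none := by
    rw [List.getElem?_append_right (by simp)]
    simp
  have heval : fLong.eval x.n (x.word ++ none :: (y.map some ++ none :: s)) ρ ↔
      (∀ a : Fin x.n, ¬ (y.map some ++ none :: s)[(a : ℕ)]? = some none) ∧
      (∀ a : Fin x.n, ¬ (y.map some ++ none :: s)[x.n + (a : ℕ)]? = some none) ∧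
      ∀ a b : Fin x.n,
        ¬ (y.map some ++ none :: s)[x.n + (x.n + ((a : ℕ) * x.n + b))]? = some none := by
    simp only [fLong, Input.word, eval_and, eval_all, eval_neg, eval_sym_sep]
    simp only [eval_sym, Skip.offset, Skip.len, add_zero]
    simp
  rw [heval]
  refine ⟨fun ⟨h1, h2, h3⟩ => ?_, fun h => ⟨fun a ha => ?_, fun a ha => ?_, fun a b hab => ?_⟩⟩
  · by_contra hlt
    by_cases hn : y.length < x.n
    · exact h1 ⟨_, hn⟩ hlen
    by_cases hn2 : y.length < x.n + x.n
    · refine h2 ⟨y.length - x.n, by omega⟩ ?_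
      rwa [show x.n + (y.length - x.n) = y.length by omega]
    · have hpos : 0 < x.n := by
        by_contra h0
        obtain h0 : x.n = 0 := by omega
        simp [h0] at hlt
      have hk : y.length - x.n - x.n < x.n * x.n := by omega
      -- Row and column of the position of the separator in the matrix block.
      refine h3 ⟨(y.length - x.n - x.n) / x.n, Nat.div_lt_of_lt_mul hk⟩
        ⟨(y.length - x.n - x.n) % x.n, Nat.mod_lt _ hpos⟩ ?_
      rwa [Nat.div_add_mod', show x.n + (x.n + (y.length - x.n - x.n)) = y.length by omega]
  · have := hsym _ ha
    have := a.2
    omega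
  · have := hsym _ ha
    have := a.2
    have hn : 0 < x.n := by omega
    have : 0 < x.n * x.n := Nat.mul_pos hn hn
    omega
  · have := hsym _ hab
    have := a.2
    have := b.2
    nlinarith

end eval

/-! ### Membership in coNP and in the second level -/

theorem notPreferredQuery_holds (x : Input) (y : List Bool) :
    notPreferredQuery.holds (Complexity.encodePair (x.encode, y)) ↔
      x.S ∉ (x.opposite.choose (certArgs x.n (y.map some)) (certAtts x.n (y.map some))).ad ∨
      (certSet x.n (y.map some) ∈
        (x.opposite.choose (certArgs x.n (y.map some)) (certAtts x.n (y.map some))).ad ∧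
        x.S ⊆ certSet x.n (y.map some) ∧ ¬ certSet x.n (y.map some) ⊆ x.S) := by
  have h := Input.inMemory_zero (x := x) (none :: y.map some)
  rw [Query.holds]
  change Query.eval (param (x.word ++ none :: y.map some)) _ (x.word ++ none :: y.map some) ↔ _
  rw [x.param_word, notPreferredQuery, Query.eval, eval_or, eval_neg, eval_fImproves eval_fCertSet,
    eval_fAdmissible (eval_S h)]

theorem preferredQuery_holds (x : Input) (y z : List Bool) :
    preferredQuery.holds (Complexity.encodeTriple (x.encode, y, z)) ↔
      x.n + (x.n + x.n * x.n) ≤ y.length ∧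
      x.S ∈ (x.opposite.choose (certArgs x.n (y.map some)) (certAtts x.n (y.map some))).ad ∧
      ¬ (certArgs x.n (z.map some) ∈
        (x.opposite.choose (certArgs x.n (y.map some)) (certAtts x.n (y.map some))).ad ∧
        x.S ⊆ certArgs x.n (z.map some) ∧ ¬ certArgs x.n (z.map some) ⊆ x.S) := by
  have h := Input.inMemory_zero (x := x) (none :: (y.map some ++ none :: z.map some))
  rw [Query.holds]
  change Query.eval (param (x.word ++ none :: (y.map some ++ none :: z.map some))) _
    (x.word ++ none :: (y.map some ++ none :: z.map some)) ↔ _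
  rw [x.param_word, preferredQuery, Query.eval, eval_and, eval_and, eval_neg, eval_fLong,
    eval_fImproves eval_fChallenge, eval_fAdmissible (eval_S h)]
  refine and_congr_right fun hy => ?_
  obtain ⟨h1, h2⟩ := cert_append hy (none :: z.map some)
  rw [h1, h2]

/-- The bound for the length of the certificates. -/
def certBound : Polynomial ℕ := .X + (.X + .X * .X)

theorem le_certBound (x : Input) : x.n + (x.n + x.n * x.n) ≤ certBound.eval x.encode.length := by
  have := x.n_le_length
  simp only [certBound, Polynomial.eval_add, Polynomial.eval_mul, Polynomial.eval_X]
  gcongr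

theorem strongRelevance_pr_false_mem_coNP :
    (strongRelevance (.pr, false)).InClass Complexity.ClassCoNP := by
  refine strongRelevance_inClass (L := {w | ¬ ∃ y : List Bool, y.length ≤ certBound.eval w.length ∧
    notPreferredQuery.holds (Complexity.encodePair (w, y))}) ?_ fun x => not_congr ?_
  · refine ⟨fun q => notPreferredQuery.holds (Complexity.encodePair q), certBound, ?_,
      fun w => not_not⟩
    simpa using notPreferredQuery.polyTimeDecidable (by decide) Complexity.encodePair id
  · simp only [notPreferredQuery_holds, HasStatus, Semantics.ext, AF.mem_pr]
    constructor
    · rintro ⟨y, -, h⟩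
      refine ⟨certArgs x.n (y.map some), certAtts x.n (y.map some), fun hpr => ?_⟩
      rcases h with h | ⟨h1, h2, h3⟩
      · exact h hpr.1
      · exact h3 (hpr.2 _ h1 h2)
    · rintro ⟨B, R, hpr⟩
      by_cases had : x.S ∈ (x.opposite.choose B R).ad
      · have : ∃ T ∈ (x.opposite.choose B R).ad, x.S ⊆ T ∧ ¬ T ⊆ x.S := by
          by_contra hcon
          exact hpr ⟨had, fun T hT hST => by_contra fun h => hcon ⟨T, hT, hST, h⟩⟩
        obtain ⟨T, hT, hST⟩ := this
        obtain ⟨y, hy, hy'⟩ := exists_certificate B T R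
        obtain ⟨h1, h2, h3⟩ := hy' []
        rw [List.append_nil] at h1 h2 h3
        refine ⟨y, hy.trans_le (le_certBound x), Or.inr ?_⟩
        rw [h1, h2, h3]
        exact ⟨hT, hST⟩
      -- If `S` is not even admissible, no larger set is needed and the candidate is arbitrary.
      · obtain ⟨y, hy, hy'⟩ := exists_certificate B ∅ R
        obtain ⟨h1, h2, h3⟩ := hy' []
        rw [List.append_nil] at h1 h2 h3
        refine ⟨y, hy.trans_le (le_certBound x), Or.inl ?_⟩
        rw [h1, h3]
        exact had

theorem strongRelevance_pr_true_mem_Pi2 :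
    (strongRelevance (.pr, true)).InClass Complexity.ClassPi2 := by
  refine strongRelevance_inClass (L := {w | ¬ ∃ y : List Bool, y.length ≤ certBound.eval w.length ∧
    ∀ z : List Bool, z.length ≤ certBound.eval w.length →
      preferredQuery.holds (Complexity.encodeTriple (w, y, z))}) ?_ fun x => not_congr ?_
  · refine ⟨fun q => preferredQuery.holds (Complexity.encodeTriple q), certBound, ?_,
      fun w => not_not⟩
    simpa using preferredQuery.polyTimeDecidable (by decide) Complexity.encodeTriple id
  · have hle := le_certBound x
    simp only [preferredQuery_holds, HasStatus, Semantics.ext, AF.mem_pr]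
    constructor
    · rintro ⟨y, -, h⟩
      -- Admissibility of `S` does not depend on the challenge, so the empty one reveals it;
      -- maximality against `T` uses the challenge that spells out `T`.
      refine ⟨_, _, (h [] (Nat.zero_le _)).2.1, fun T hT hST => ?_⟩
      obtain ⟨z, hz, hz'⟩ := exists_bits T
      have hzT : certArgs x.n (z.map some) = T := by
        ext a
        simp [certArgs, ← hz' a]
      have := (h z (by omega)).2.2
      rw [hzT] at this
      by_contra hTS
      exact this ⟨hT, hST, hTS⟩
    · rintro ⟨B, R, had, hmax⟩
      obtain ⟨y, hy, hy'⟩ := exists_certificate B ∅ R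
      obtain ⟨h1, -, h3⟩ := hy' []
      rw [List.append_nil] at h1 h3
      refine ⟨y, hy.trans_le hle, fun z _ => ⟨hy.ge, ?_⟩⟩
      rw [h1, h3]
      exact ⟨had, fun ⟨hT, hST, hTS⟩ => hTS (hmax _ hT hST)⟩

end Argumentation

end

theorem corollary4 :
    (∀ σ ∈ ({.ad, .st, .co, .gr} : Set Argumentation.Semantics), ∀ b : Bool,
      (Argumentation.strongRelevance (σ, b)).InClass Complexity.ClassP) ∧
    (Argumentation.strongRelevance (.pr, true)).InClass Complexity.ClassPi2 ∧
    (Argumentation.strongRelevance (.pr, false)).InClass Complexity.ClassCoNP := by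
  refine ⟨fun σ hσ b => Argumentation.strongRelevance_mem_P ?_ b,
    Argumentation.strongRelevance_pr_true_mem_Pi2, Argumentation.strongRelevance_pr_false_mem_coNP⟩
  rintro rfl
  simp at hσ
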